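/- **Setting.** A *group pair* $(G,\mathcal P)$ consists of a finitely generated group $G$, endowed with a chosen word metric $d_G$ (for a finite generating set), and a finite set $\mathcal P$ of infinite subgroups of $G$. Let $G/\mathcal P$ be the set of all left cosets $gP$ with $g\in G$, $P\in\mathcal P$. For subsets $A,B$ of a metric space $X$ let $d(A,B)$ be the infimum of the distances between their points, $\mathrm{hdist}(A,B)$ their Hausdorff distance, and $\mathcal N_r(A)=\{x : \exists a\in A,\ d(a,x)\le r\}$. A *quasi-isometry of group pairs* $(G,\mathcal P)\to(H,\mathcal Q)$ is a quasi-isometry $q\colon G\to H$ for which there is $M>0$ such that for every $A\in G/\mathcal P$ there is $B\in H/\mathcal Q$ with $\mathrm{hdist}(q(A),B)<M$, and for every $B\in H/\mathcal Q$ there is $A\in G/\mathcal P$ with $\mathrm{hdist}(q(A),B)<M$. Two group pairs are *virtually isomorphic* if, up to isomorphism of pairs and irrespective of the word metrics, one is obtained from the other by finitely many of the following operations and their inverses: (i) replace $\mathcal P$ by a finite set $\mathcal Q$ of subgroups of $G$ such that each $Q\in\mathcal Q$ is commensurable to a conjugate of some $P\in\mathcal P$ and vice versa; (ii) replace $(G,\mathcal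 P)$ by $(G/N,\{PN/N : P\in\mathcal P\})$ with $N$ a finite normal subgroup; (iii) replace $(G,\mathcal P)$ by $(H,\{g_iP_ig_i^{-1}\cap H : i\in I\})$ with $H\le G$ of finite index and $\{g_iP_i : i\in I\}$ a set of representatives of the $H$-orbits in $G/\mathcal P$. A property of group pairs is *geometric* if every group pair quasi-isometric to one with the property is virtually isomorphic to one with the property. It is a *quasi-isometry invariant* if, of two quasi-isometric group pairs, one has it if and only if the other has it. **Properties.** 1. *Finite height*: there is a bound on the $m$ for which there are $m$ distinct cosets $g_1P_1,\dots,g_mP_m\in G/\mathcal P$ with $\bigcap_i g_iP_ig_i^{-1}$ infinite. 2. *Finite width*: there is a bound on the $m$ for which there are $m$ distinct cosets $g_1P_1,\dots,g_mP_m\in G/\mathcal P$ with $g_iP_ig_i^{-1}\cap g_jP_jg_j^{-1}$ infinite for all $i<j$. 3. *Fenced infinite intersections*: there is $\tau\ge0$ such that $d_G(g_1P_1,g_2P_2)\le\tau$ whenever $g_1P_1,g_2P_2\in G/\mathcal P$ and $g_1P_1g_1^{-1}\cap g_2P_2g_2^{-1}$ is infinite. 4. *Almost malnormality*: for all $P,Q\in\mathcal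 P$ and $g\in G$, either $gPg^{-1}\cap Q$ is finite, or $P=Q$ and $g\in P$. 5. *Network*: $\mathcal P\neq\emptyset$ and for some $\tau\ge0$ the space $G$ is a $\tau$-network with respect to $G/\mathcal P$. Here $X$ is a $\tau$-network with respect to a collection $\mathcal L$ of subsets if $X=\bigcup_{L\in\mathcal L}\mathcal N_\tau(L)$ and any $L,L'\in\mathcal L$ are joined by a sequence $L=L_1,\dots,L_n=L'$ in $\mathcal L$ with $\mathcal N_\tau(L_i)\cap\mathcal N_\tau(L_{i+1})$ unbounded for all $i<n$. 6. *Thick of order $1$*: for some $\tau\ge0$ the space $G$ is a $\tau$-network with respect to $G/\mathcal P$; the collection $G/\mathcal P$, each member with the metric restricted from $G$, is uniformly thick of order $0$; and $\{G\}$ is not uniformly thick of order $0$. Here a collection $\mathcal Y$ of metric spaces is *uniformly thick of order $0$* if (a) there are constants $l\ge 1$ and $k,c\ge 0$ such that every point of every $Y\in\mathcal Y$ is at distance at most $c$ from a bi-infinite $(l,k)$-quasi-geodesic in $Y$, and (b) for every sequence $(Y_i)$ in $\mathcal Y$ there are a nonprincipal ultrafilter $\omega$ on $\mathbb N$ and positive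 scaling constants $d_i$ with $\lim_\omega d_i=\infty$ such that, for all base points $b_i\in Y_i$, the asymptotic cone $\lim_\omega(Y_i,b_i,\tfrac1{d_i}d_{Y_i})$ has no cut point (a point $x$ is a cut point if its complement contains two points not joined by a path in the complement). 7. $P=\mathrm{Comm}_G(P)$ for every $P\in\mathcal P$, where $\mathrm{Comm}_G(P)=\{g\in G : P\cap gPg^{-1}\text{ has finite index in }P\text{ and in }gPg^{-1}\}$. 8. $P$ has finite index in $\mathrm{Comm}_G(P)$ for every $P\in\mathcal P$. 9. *Bounded packing*: for every $D$ there is $N$ such that among any $N$ distinct cosets in $G/\mathcal P$ at least two are at distance $d_G\ge D$. 10. *Finite packing*: there is a finite set $D\subseteq G/\mathcal P$ such that for any $g_1P_1,\dots,g_mP_m\in G/\mathcal P$ with $\bigcap_i g_iP_ig_i^{-1}$ infinite there is $g\in G$ with $gg_iP_i\in D$ for all $i$. **Theorem 1.3.** Each of the properties 1–10 is a geometric property of group pairs. Moreover each of the properties 1, 2, 3, 5, 6, 8, 9, 10 is a quasi-isometry invariant of group pairs. -/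

import Mathlib

open scoped Pointwise NNReal Topology

universe u

namespace CosetGeom

/-! ### Coarse notions for subsets of a metric space -/

section Metric

variable {X : Type*} [PseudoMetricSpace X]

/-- The closed `r`-neighbourhood of `A`. -/
def nbhd (r : ℝ) (A : Set X) : Set X := {x | ∃ a ∈ A, dist a x ≤ r}

/-- The infimum distance between two (nonempty) subsets. -/
noncomputable def setDist (A B : Set X) : ℝ :=
  sInf {t | ∃ a ∈ A, ∃ b ∈ B, dist a b = t}

/-- `q` is an `(L, C)`-quasi-isometry. -/
structure IsQuasiIsometry {Y : Type*} [PseudoMetricSpace Y] (L C : ℝ) (q : X → Y) : Prop where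
  one_le : 1 ≤ L
  nonneg : 0 ≤ C
  lower : ∀ a b, (1 / L) * dist a b - C ≤ dist (q a) (q b)
  upper : ∀ a b, dist (q a) (q b) ≤ L * dist a b + C
  coarse_surj : ∀ y, ∃ x, dist (q x) y ≤ C

/-- `q` is an `(L, C, M)`-quasi-isometry of pairs `(X, 𝒜) → (Y, ℬ)`. -/
structure IsQuasiIsometryOfPairs {Y : Type*} [PseudoMetricSpace Y] (L C M : ℝ)
    (𝒜 : Set (Set X)) (ℬ : Set (Set Y)) (q : X → Y) : Prop where
  quasiIsometry : IsQuasiIsometry L C q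
  pos : 0 < M
  forth : ∀ A ∈ 𝒜, ∃ B ∈ ℬ, Metric.hausdorffEDist (q '' A) B < ENNReal.ofReal M
  back : ∀ B ∈ ℬ, ∃ A ∈ 𝒜, Metric.hausdorffEDist (q '' A) B < ENNReal.ofReal M

/-- `X` is a `τ`-network with respect to the collection `ℒ` of subsets. -/
def IsNetworkWith (τ : ℝ) (ℒ : Set (Set X)) : Prop :=
  (∀ x : X, ∃ A ∈ ℒ, x ∈ nbhd τ A) ∧
  ∀ A ∈ ℒ, ∀ B ∈ ℒ, ∃ (n : ℕ) (S : ℕ → Set X), S 0 = A ∧ S n = B ∧ (∀ i ≤ n, S i ∈ ℒ) ∧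
    ∀ i < n, ¬ Bornology.IsBounded (nbhd τ (S i) ∩ nbhd τ (S (i + 1)))

end Metric

/-! ### Asymptotic cones and thickness -/

section Cone

variable (ω : Ultrafilter ℕ) (d : ℕ → ℝ≥0) (B : ℕ → Type*) [∀ i, PseudoMetricSpace (B i)]
  (b : ∀ i, B i)

/-- Sequences at `ω`-bounded rescaled distance from the sequence of base points `b`. -/
def ConeSeq : Type _ :=
  {x : ∀ i, B i // ∃ r : ℝ, ∀ᶠ i in (ω : Filter ℕ), dist (x i) (b i) / d i ≤ r}

variable {ω d B b}

/-- The `ω`-limit of the rescaled distances between two sequences. -/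
noncomputable def coneDist (x y : ConeSeq ω d B b) : ℝ :=
  Filter.limUnder (ω : Filter ℕ) fun i => dist (x.1 i) (y.1 i) / (d i : ℝ)

theorem tendsto_coneDist (x y : ConeSeq ω d B b) :
    Filter.Tendsto (fun i => dist (x.1 i) (y.1 i) / (d i : ℝ)) (ω : Filter ℕ)
      (𝓝 (coneDist x y)) := by
  obtain ⟨r, hr⟩ := x.2
  obtain ⟨s, hs⟩ := y.2
  refine tendsto_nhds_limUnder ?_
  have hev : ∀ᶠ i in (ω : Filter ℕ),
      dist (x.1 i) (y.1 i) / (d i : ℝ) ∈ Set.Icc (0 : ℝ) (r + s) := by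
    filter_upwards [hr, hs] with i h1 h2
    refine ⟨by positivity, ?_⟩
    calc dist (x.1 i) (y.1 i) / (d i : ℝ)
        ≤ (dist (x.1 i) (b i) + dist (y.1 i) (b i)) / (d i : ℝ) := by
          gcongr; exact dist_triangle_right _ _ _
      _ = dist (x.1 i) (b i) / (d i : ℝ) + dist (y.1 i) (b i) / (d i : ℝ) := add_div _ _ _
      _ ≤ r + s := add_le_add h1 h2
  obtain ⟨a, -, ha⟩ := (isCompact_Icc (a := (0 : ℝ)) (b := r + s)).ultrafilter_le_nhds
    (ω.map fun i => dist (x.1 i) (y.1 i) / (d i : ℝ))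
    (Filter.le_principal_iff.2 hev)
  exact ⟨a, ha⟩

noncomputable instance : PseudoMetricSpace (ConeSeq ω d B b) where
  dist := coneDist
  dist_self x := by
    refine tendsto_nhds_unique (tendsto_coneDist x x) ?_
    simp
  dist_comm x y := by
    refine tendsto_nhds_unique (tendsto_coneDist x y) ?_
    simpa [dist_comm] using tendsto_coneDist y x
  dist_triangle x y z := by
    refine le_of_tendsto_of_tendsto' (tendsto_coneDist x z)
      ((tendsto_coneDist x y).add (tendsto_coneDist y z)) fun i => ?_
    rw [← add_div]
    gcongr
    exact dist_triangle _ _ _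

variable (ω d B b)

/-- The ultralimit `lim_ω (B i, dist / d i, b i)`, a metric space: sequences at `ω`-bounded rescaled
distance from `b`, with points at limit distance zero identified. For `d → ∞` along `ω` this is the
asymptotic cone. -/
abbrev Cone : Type _ := SeparationQuotient (ConeSeq ω d B b)

end Cone

/-- `x` is a cut point of `Y`: the complement of `x` is not path connected, i.e. it contains two
points which cannot be joined by a path avoiding `x`. -/
def IsCutPoint {Y : Type*} [TopologicalSpace Y] (x : Y) : Prop :=
  ∃ y z : Y, y ≠ x ∧ z ≠ x ∧ ¬ JoinedIn {x}ᶜ y z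

section Thick

variable {X : Type*} [PseudoMetricSpace X]

/-- A bi-infinite `(l, k)`-quasi-geodesic. -/
def IsBiinfiniteQuasiGeodesic {Y : Type*} [PseudoMetricSpace Y] (l k : ℝ) (γ : ℝ → Y) : Prop :=
  ∀ s t : ℝ, (1 / l) * |s - t| - k ≤ dist (γ s) (γ t) ∧ dist (γ s) (γ t) ≤ l * |s - t| + k

/-- The collection `𝒴` of subspaces of `X`, each with the restricted metric, is uniformly
unconstricted, i.e. uniformly thick of order `0`: points of members of `𝒴` are uniformly close to
bi-infinite quasi-geodesics with uniform constants in that member, and for every sequence of members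
there are a nonprincipal ultrafilter and scaling constants tending to infinity such that, for all
choices of base points, the resulting asymptotic cone has no cut point. -/
def UniformlyThickZero (𝒴 : Set (Set X)) : Prop :=
  (∃ l k c : ℝ, 1 ≤ l ∧ 0 ≤ k ∧ 0 ≤ c ∧ ∀ Y ∈ 𝒴, ∀ y : Y, ∃ γ : ℝ → Y,
    IsBiinfiniteQuasiGeodesic l k γ ∧ ∃ t, dist y (γ t) ≤ c) ∧
  ∀ B : ℕ → Set X, (∀ i, B i ∈ 𝒴) →
    ∃ (ω : Ultrafilter ℕ) (d : ℕ → ℝ≥0), (ω : Filter ℕ) ≤ Filter.cofinite ∧ (∀ i, 0 < d i) ∧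
      Filter.Tendsto d (ω : Filter ℕ) Filter.atTop ∧
      ∀ b : ∀ i, B i, ∀ x : Cone ω d (fun i => B i) b, ¬ IsCutPoint x

variable (X) in
/-- The space `X` is thick of order `0`. -/
def ThickZero : Prop := UniformlyThickZero {(Set.univ : Set X)}

/-- `X` is thick of order at most `1` with respect to `𝒴`. -/
def ThickAtMostOne (𝒴 : Set (Set X)) : Prop :=
  (∃ τ : ℝ, 0 ≤ τ ∧ IsNetworkWith τ 𝒴) ∧ UniformlyThickZero 𝒴

end Thick

/-! ### Group pairs -/

/-- A group pair: a finitely generated group `G` and a finite collection of infinite subgroups,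
together with the finite generating set which defines the chosen word metric on `G`. -/
structure GroupPair where
  G : Type u
  [group : Group G]
  gens : Set G
  gens_finite : gens.Finite
  gens_closure : Subgroup.closure gens = ⊤
  periph : Set (Subgroup G)
  periph_finite : periph.Finite
  periph_infinite : ∀ P ∈ periph, (P : Set G).Infinite

attribute [instance] GroupPair.group

section WordMetric

variable {G : Type*} [Group G]

/-- `g` is the product of a word of length `n` in the elements of `S` and their inverses. -/
def IsWordOfLength (S : Set G) (n : ℕ) (g : G) : Prop :=
  ∃ l : List G, l.length = n ∧ (∀ s ∈ l, s ∈ S ∨ s⁻¹ ∈ S) ∧ l.prod = g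

/-- The word length of `g` with respect to the generating set `S`. -/
noncomputable def wordLength (S : Set G) (g : G) : ℕ := sInf {n | IsWordOfLength S n g}

theorem isWordOfLength_wordLength {S : Set G} (hS : Subgroup.closure S = ⊤) (g : G) :
    IsWordOfLength S (wordLength S g) g := by
  have hg : g ∈ Subgroup.closure S := by rw [hS]; trivial
  rw [← Subgroup.mem_toSubmonoid, Subgroup.closure_toSubmonoid] at hg
  obtain ⟨l, hl, hp⟩ := Submonoid.exists_list_of_mem_closure hg
  replace hl : ∀ s ∈ l, s ∈ S ∨ s⁻¹ ∈ S := fun s hs => by simpa using hl s hs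
  exact Nat.sInf_mem (s := {n | IsWordOfLength S n g}) ⟨l.length, l, rfl, hl, hp⟩

theorem wordLength_le {S : Set G} {n : ℕ} {g : G} (h : IsWordOfLength S n g) :
    wordLength S g ≤ n := Nat.sInf_le h

theorem wordLength_one (S : Set G) : wordLength S (1 : G) = 0 :=
  Nat.le_zero.1 (wordLength_le ⟨[], rfl, by simp, rfl⟩)

theorem wordLength_inv_le {S : Set G} (hS : Subgroup.closure S = ⊤) (g : G) :
    wordLength S g⁻¹ ≤ wordLength S g := by
  obtain ⟨l, h1, h2, h3⟩ := isWordOfLength_wordLength hS g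
  refine wordLength_le ⟨(l.map fun x => x⁻¹).reverse, by simp [h1], ?_, ?_⟩
  · intro s hs
    simp only [List.mem_reverse, List.mem_map] at hs
    obtain ⟨x, hx, rfl⟩ := hs
    simpa using (h2 x hx).symm
  · rw [← List.prod_inv_reverse, h3]

theorem wordLength_mul_le {S : Set G} (hS : Subgroup.closure S = ⊤) (g h : G) :
    wordLength S (g * h) ≤ wordLength S g + wordLength S h := by
  obtain ⟨l, h1, h2, h3⟩ := isWordOfLength_wordLength hS g
  obtain ⟨m, k1, k2, k3⟩ := isWordOfLength_wordLength hS h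
  refine wordLength_le ⟨l ++ m, by simp [h1, k1], ?_, by simp [h3, k3]⟩
  intro s hs
  rcases List.mem_append.1 hs with hs | hs
  · exact h2 s hs
  · exact k2 s hs

theorem eq_one_of_wordLength_eq_zero {S : Set G} (hS : Subgroup.closure S = ⊤) {g : G}
    (h : wordLength S g = 0) : g = 1 := by
  obtain ⟨l, h1, -, h3⟩ := isWordOfLength_wordLength hS g
  rw [h, List.length_eq_zero_iff] at h1
  simpa [h1] using h3.symm

end WordMetric

namespace GroupPair

/-- The (left-invariant) word metric `dist g h = |g⁻¹ h|`. -/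
noncomputable instance (A : GroupPair.{u}) : MetricSpace A.G where
  dist g h := wordLength A.gens (g⁻¹ * h)
  dist_self g := by simp [wordLength_one]
  dist_comm g h := by
    have key : ∀ x y : A.G, wordLength A.gens (x⁻¹ * y) ≤ wordLength A.gens (y⁻¹ * x) := by
      intro x y
      simpa using wordLength_inv_le A.gens_closure (y⁻¹ * x)
    exact_mod_cast le_antisymm (key g h) (key h g)
  dist_triangle g h k := by
    have := wordLength_mul_le A.gens_closure (g⁻¹ * h) (h⁻¹ * k)
    rw [show g⁻¹ * h * (h⁻¹ * k) = g⁻¹ * k by group] at this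
    exact_mod_cast this
  eq_of_dist_eq_zero {g h} hgh := by
    have := eq_one_of_wordLength_eq_zero A.gens_closure (g := g⁻¹ * h) (by exact_mod_cast hgh)
    exact (inv_mul_eq_one.1 this)

/-- The conjugate `g P g⁻¹`. -/
abbrev conj {G : Type*} [Group G] (g : G) (P : Subgroup G) : Subgroup G :=
  ConjAct.toConjAct g • P

/-- The set `G / 𝒫` of all left cosets `gP` with `g ∈ G` and `P ∈ 𝒫`. -/
def cosets (A : GroupPair.{u}) : Set (Set A.G) :=
  {C | ∃ g : A.G, ∃ P ∈ A.periph, C = g • (P : Set A.G)}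

/-- `g` and `P` describe a family `g 0 P 0, …, g (m-1) P (m-1)` of distinct elements of
`G / 𝒫`. -/
def IsDistinctFamily (A : GroupPair.{u}) {m : ℕ} (g : Fin m → A.G) (P : Fin m → Subgroup A.G) :
    Prop :=
  (∀ i, P i ∈ A.periph) ∧ Function.Injective fun i => g i • (P i : Set A.G)

/-! ### The properties -/

/-- Finite height: there is a bound on the number `m` of distinct cosets `gᵢPᵢ` such that the
intersection of all the `gᵢPᵢgᵢ⁻¹` is infinite. -/
def FiniteHeight (A : GroupPair.{u}) : Prop :=
  ∃ N : ℕ, ∀ (m : ℕ) (g : Fin m → A.G) (P : Fin m → Subgroup A.G), A.IsDistinctFamily g P →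
    ((⨅ i, conj (g i) (P i) : Subgroup A.G) : Set A.G).Infinite → m ≤ N

/-- Finite width: there is a bound on the number `m` of distinct cosets `gᵢPᵢ` such that the
pairwise intersections of the `gᵢPᵢgᵢ⁻¹` are infinite. -/
def FiniteWidth (A : GroupPair.{u}) : Prop :=
  ∃ N : ℕ, ∀ (m : ℕ) (g : Fin m → A.G) (P : Fin m → Subgroup A.G), A.IsDistinctFamily g P →
    (∀ i j, i < j → ((conj (g i) (P i) ⊓ conj (g j) (P j) : Subgroup A.G) : Set A.G).Infinite) →
      m ≤ N

/-- Fenced infinite intersections. -/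
def FencedInfiniteIntersections (A : GroupPair.{u}) : Prop :=
  ∃ τ : ℝ, 0 ≤ τ ∧ ∀ (g₁ g₂ : A.G), ∀ P₁ ∈ A.periph, ∀ P₂ ∈ A.periph,
    ((conj g₁ P₁ ⊓ conj g₂ P₂ : Subgroup A.G) : Set A.G).Infinite →
      setDist (g₁ • (P₁ : Set A.G)) (g₂ • (P₂ : Set A.G)) ≤ τ

/-- Almost malnormality of the collection `𝒫`. -/
def AlmostMalnormal (A : GroupPair.{u}) : Prop :=
  ∀ P ∈ A.periph, ∀ Q ∈ A.periph, ∀ g : A.G,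
    ((conj g P ⊓ Q : Subgroup A.G) : Set A.G).Finite ∨ (P = Q ∧ g ∈ P)

/-- `𝒫` is nonempty and `G` is a network with respect to `G / 𝒫`. -/
def IsNetwork (A : GroupPair.{u}) : Prop :=
  A.periph.Nonempty ∧ ∃ τ : ℝ, 0 ≤ τ ∧ IsNetworkWith τ A.cosets

/-- `(G, 𝒫)` is thick of order one: `G` is thick of order at most one with respect to `G / 𝒫`, and
not thick of order zero. -/
def ThickOfOrderOne (A : GroupPair.{u}) : Prop :=
  ThickAtMostOne A.cosets ∧ ¬ ThickZero A.G

/-- Every `P ∈ 𝒫` equals its commensurator. -/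
def EqCommensurator (A : GroupPair.{u}) : Prop :=
  ∀ P ∈ A.periph, P = Subgroup.Commensurable.commensurator P

/-- Every `P ∈ 𝒫` has finite index in its commensurator. -/
def FiniteIndexInCommensurator (A : GroupPair.{u}) : Prop :=
  ∀ P ∈ A.periph, P.relIndex (Subgroup.Commensurable.commensurator P) ≠ 0

/-- Bounded packing: for each `D` there is `N` such that among any `N` distinct cosets at least two
are separated by a distance of at least `D`. -/
def BoundedPacking (A : GroupPair.{u}) : Prop :=
  ∀ D : ℝ, ∃ N : ℕ, ∀ (g : Fin N → A.G) (P : Fin N → Subgroup A.G), A.IsDistinctFamily g P →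
    ∃ i j, i ≠ j ∧ D ≤ setDist (g i • (P i : Set A.G)) (g j • (P j : Set A.G))

/-- Finite packing: there is a finite set `D` of cosets such that every finite family of cosets with
infinite intersection of the `gᵢPᵢgᵢ⁻¹` has a translate in `D`. -/
def FinitePacking (A : GroupPair.{u}) : Prop :=
  ∃ D : Set (Set A.G), D.Finite ∧ D ⊆ A.cosets ∧
    ∀ (m : ℕ) (g : Fin m → A.G) (P : Fin m → Subgroup A.G), (∀ i, P i ∈ A.periph) →
      ((⨅ i, conj (g i) (P i) : Subgroup A.G) : Set A.G).Infinite →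
        ∃ h : A.G, ∀ i, h • g i • (P i : Set A.G) ∈ D

/-! ### Quasi-isometry, virtual isomorphism, geometric properties -/

/-- Quasi-isometric group pairs. -/
def QuasiIsometric (A B : GroupPair.{u}) : Prop :=
  ∃ (L C M : ℝ) (q : A.G → B.G), IsQuasiIsometryOfPairs L C M A.cosets B.cosets q

/-- The elementary operations generating virtual isomorphism of group pairs; groups are taken up to
isomorphism, and no relation is imposed between the chosen word metrics. -/
inductive VirtualStep : GroupPair.{u} → GroupPair.{u} → Prop
  /-- Keep the group, and replace `𝒫` by a finite collection `𝒬` such that each `Q ∈ 𝒬` is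
  commensurable to a conjugate of some `P ∈ 𝒫` and vice versa. -/
  | commensurable {A B : GroupPair.{u}} (e : A.G ≃* B.G)
      (h₁ : ∀ Q ∈ B.periph, ∃ P ∈ A.periph, ∃ g : B.G,
        Subgroup.Commensurable Q (conj g (P.map e.toMonoidHom)))
      (h₂ : ∀ P ∈ A.periph, ∃ Q ∈ B.periph, ∃ g : B.G,
        Subgroup.Commensurable (P.map e.toMonoidHom) (conj g Q)) : VirtualStep A B
  /-- Replace `(G, 𝒫)` by its quotient by a finite normal subgroup (the kernel of `f`). -/
  | quotient {A B : GroupPair.{u}} (f : A.G →* B.G) (hf : Function.Surjective f)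
      (hker : (f.ker : Set A.G).Finite)
      (h : B.periph = {Q | ∃ P ∈ A.periph, Q = P.map f}) : VirtualStep A B
  /-- Pass to a finite index subgroup `H` of `G` (the range of the injective map `f`), with
  peripheral structure the `gPg⁻¹ ∩ H`, for `(g, P)` in a set `R` of pairs such that the cosets `gP`
  represent the `H`-orbits in `G / 𝒫`, one for each orbit. -/
  | subgroup {A B : GroupPair.{u}} (f : B.G →* A.G) (hf : Function.Injective f)
      (hind : f.range.FiniteIndex) (R : Set (A.G × Subgroup A.G))
      (hR : ∀ r ∈ R, r.2 ∈ A.periph)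
      (hrep : ∀ C ∈ A.cosets, ∃! r, r ∈ R ∧ ∃ h ∈ f.range, h • r.1 • (r.2 : Set A.G) = C)
      (h : B.periph = {Q | ∃ r ∈ R, Q = (conj r.1 r.2).comap f}) : VirtualStep A B

/-- Virtually isomorphic group pairs: related by a finite sequence of the operations and their
inverses. -/
def VirtuallyIsomorphic : GroupPair.{u} → GroupPair.{u} → Prop := Relation.EqvGen VirtualStep

/-- A property of group pairs is geometric if every group pair quasi-isometric to one with the
property is virtually isomorphic to one with the property. -/
def IsGeometric (𝔓 : GroupPair.{u} → Prop) : Prop :=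
  ∀ A B : GroupPair.{u}, QuasiIsometric A B → 𝔓 B → ∃ K, 𝔓 K ∧ VirtuallyIsomorphic K A

/-- A property of group pairs is a quasi-isometry invariant. -/
def IsQuasiIsometryInvariant (𝔓 : GroupPair.{u} → Prop) : Prop :=
  ∀ A B : GroupPair.{u}, QuasiIsometric A B → (𝔓 A ↔ 𝔓 B)

end GroupPair

end CosetGeom

/-!
A quasi-isometry of pairs `q` sends each coset `A ∈ G / 𝒫` to within bounded Hausdorff distance of
some coset `f A ∈ H / 𝒬`. The proof translates each property into the coarse geometry of the
collection of cosets and then transports it along `q` and `f`.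

The dictionary between algebra and geometry is as follows. A subgroup `gPg⁻¹` is at finite Hausdorff
distance from the coset `gP`, and by the pigeonhole principle a finite intersection of the `gᵢPᵢgᵢ⁻¹`
is infinite exactly when the cosets `gᵢPᵢ` have uniform neighbourhoods with unbounded intersection
(`infinite_iInf_conj_iff`). Two conjugates are commensurable exactly when the corresponding cosets
are at finite Hausdorff distance (`commensurable_conj_iff_near`), so `P` has finite index in its
commensurator exactly when finitely many cosets are at finite Hausdorff distance from `P`. Since
boundedly many cosets meet a ball of given radius, the map `f` has uniformly bounded fibres
(`exists_encard_fiber_le`), and bounds on the size of families of distinct cosets pull back along `f`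
at the cost of a factor (`exists_card_le_of_map`). As the inverse of a quasi-isometry of pairs is
again one, one direction of each invariance statement suffices. For thickness, `q` restricts to
uniform quasi-isometries between corresponding cosets, and these induce bi-Lipschitz homeomorphisms
of asymptotic cones, which preserve cut points (`nonempty_homeomorph_cone`).

A quasi-isometry invariant is geometric. The two remaining properties, `P = Comm_G(P)` and almost
malnormality, both imply that the `P` have finite index in their commensurators, and this passes to
`(G, 𝒫)` from the pair quasi-isometric to it. Hence replacing the `P` by their commensurators gives a
virtually isomorphic pair, whose peripheral subgroups are their own commensurators. In the almost
malnormal case one keeps one commensurator for each conjugacy class: if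
`g Comm(P) g⁻¹ ∩ Comm(P')` is infinite, so is `gPg⁻¹ ∩ P'`; then `gP` and `P'` go to the same coset
under `f`, so that `gPg⁻¹` and `P'` are commensurable and `g Comm(P) g⁻¹ = Comm(P')`.
-/

namespace CosetGeom

/-! ### Coarse geometry of collections of subsets -/

section Coarse

variable {X Y : Type*} [PseudoMetricSpace X] [PseudoMetricSpace Y]

/-- `S` and `T` are at Hausdorff distance at most `r`, with the closed neighbourhoods `nbhd`. -/
def Near (r : ℝ) (S T : Set X) : Prop := S ⊆ nbhd r T ∧ T ⊆ nbhd r S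

/-- The family `S` has coarsely unbounded intersection: the `r`-neighbourhoods of its members have
an unbounded common intersection, for some `r`. -/
def CoarselyMeet {ι : Type*} (S : ι → Set X) : Prop :=
  ∃ r : ℝ, ¬ Bornology.IsBounded (⋂ i, nbhd r (S i))

/-- The number of members of `𝒜` which meet a closed ball of radius `r` is bounded in terms
of `r` only. -/
def UniformlyLocallyFinite (𝒜 : Set (Set X)) : Prop :=
  ∀ r : ℝ, ∃ N : ℕ, ∀ x, {S ∈ 𝒜 | x ∈ nbhd r S}.encard ≤ N

theorem nbhd_mono {r s : ℝ} (h : r ≤ s) (S : Set X) : nbhd r S ⊆ nbhd s S :=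
  fun _ ⟨a, ha, hd⟩ => ⟨a, ha, hd.trans h⟩

theorem subset_nbhd {r : ℝ} (hr : 0 ≤ r) (S : Set X) : S ⊆ nbhd r S :=
  fun x hx => ⟨x, hx, by simpa using hr⟩

theorem nbhd_subset_nbhd {r : ℝ} {S T : Set X} (h : S ⊆ nbhd r T) (s : ℝ) :
    nbhd s S ⊆ nbhd (r + s) T := by
  rintro x ⟨a, ha, hax⟩
  obtain ⟨t, ht, hta⟩ := h ha
  exact ⟨t, ht, (dist_triangle t a x).trans (add_le_add hta hax)⟩

theorem Near.symm {r : ℝ} {S T : Set X} (h : Near r S T) : Near r T S := ⟨h.2, h.1⟩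

theorem Near.refl {r : ℝ} (hr : 0 ≤ r) (S : Set X) : Near r S S :=
  ⟨subset_nbhd hr S, subset_nbhd hr S⟩

theorem Near.trans {r s : ℝ} {S T U : Set X} (h : Near r S T) (h' : Near s T U) :
    Near (r + s) S U := by
  refine ⟨fun x hx => ?_, fun x hx => ?_⟩
  · rw [add_comm]; exact nbhd_subset_nbhd h'.1 r (h.1 hx)
  · exact nbhd_subset_nbhd h.2 s (h'.2 hx)

theorem Near.of_hausdorffEDist_lt {M : ℝ} {S T : Set X}
    (h : Metric.hausdorffEDist S T < ENNReal.ofReal M) : Near M S T := by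
  have key : ∀ {S T : Set X}, Metric.hausdorffEDist S T < ENNReal.ofReal M → S ⊆ nbhd M T := by
    intro S T h x hx
    obtain ⟨y, hy, hd⟩ := Metric.exists_edist_lt_of_hausdorffEDist_lt hx h
    rw [edist_dist] at hd
    exact ⟨y, hy, by rw [dist_comm]; exact (ENNReal.ofReal_lt_ofReal_iff'.1 hd).1.le⟩
  exact ⟨key h, key (by rwa [Metric.hausdorffEDist_comm])⟩

theorem Near.hausdorffEDist_lt {r M : ℝ} {S T : Set X} (h : Near r S T) (hrM : r < M)
    (hM : 0 < M) : Metric.hausdorffEDist S T < ENNReal.ofReal M := by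
  refine lt_of_le_of_lt (Metric.hausdorffEDist_le_of_mem_edist (r := ENNReal.ofReal r) ?_ ?_)
    ((ENNReal.ofReal_lt_ofReal_iff hM).2 hrM)
  · intro x hx
    obtain ⟨y, hy, hd⟩ := h.1 hx
    exact ⟨y, hy, by rw [edist_dist, dist_comm]; exact ENNReal.ofReal_le_ofReal hd⟩
  · intro x hx
    obtain ⟨y, hy, hd⟩ := h.2 hx
    exact ⟨y, hy, by rw [edist_dist, dist_comm]; exact ENNReal.ofReal_le_ofReal hd⟩

theorem CoarselyMeet.mono {ι : Type*} {S T : ι → Set X} (h : CoarselyMeet S) {r : ℝ}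
    (hST : ∀ i, S i ⊆ nbhd r (T i)) : CoarselyMeet T := by
  obtain ⟨s, hs⟩ := h
  exact ⟨r + s, fun hb => hs (hb.subset (Set.iInter_mono fun i => nbhd_subset_nbhd (hST i) s))⟩

theorem CoarselyMeet.comp {ι κ : Type*} {S : ι → Set X} (h : CoarselyMeet S) (e : κ → ι) :
    CoarselyMeet (S ∘ e) := by
  obtain ⟨s, hs⟩ := h
  exact ⟨s, fun hb => hs (hb.subset fun x hx => Set.mem_iInter.2 fun i =>
    Set.mem_iInter.1 hx (e i))⟩

theorem setDist_lt_iff {A B : Set X} (hA : A.Nonempty) (hB : B.Nonempty) {D : ℝ} :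
    setDist A B < D ↔ ∃ a ∈ A, ∃ b ∈ B, dist a b < D := by
  obtain ⟨a, ha⟩ := hA
  obtain ⟨b, hb⟩ := hB
  have hbdd : BddBelow {t : ℝ | ∃ a ∈ A, ∃ b ∈ B, dist a b = t} := by
    refine ⟨0, ?_⟩
    rintro t ⟨a, -, b, -, rfl⟩
    exact dist_nonneg
  rw [setDist, csInf_lt_iff hbdd ⟨_, a, ha, b, hb, rfl⟩]
  constructor
  · rintro ⟨t, ⟨a, ha, b, hb, rfl⟩, ht⟩
    exact ⟨a, ha, b, hb, ht⟩
  · rintro ⟨a, ha, b, hb, h⟩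
    exact ⟨_, ⟨a, ha, b, hb, rfl⟩, h⟩

namespace IsQuasiIsometry

variable {L C M : ℝ} {q : X → Y}

theorem dist_le (h : IsQuasiIsometry L C q) (a b : X) :
    dist a b ≤ L * (dist (q a) (q b) + C) := by
  have h1 := h.lower a b
  have hL : 0 < L := lt_of_lt_of_le one_pos h.one_le
  rw [one_div, sub_le_iff_le_add, inv_mul_le_iff₀ hL] at h1
  exact h1

theorem of_dist_le {L C : ℝ} {q : X → Y} (hL : 1 ≤ L) (hC : 0 ≤ C)
    (lower : ∀ a b, dist a b ≤ L * (dist (q a) (q b) + C))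
    (upper : ∀ a b, dist (q a) (q b) ≤ L * dist a b + C)
    (surj : ∀ y, ∃ x, dist (q x) y ≤ C) : IsQuasiIsometry L C q where
  one_le := hL
  nonneg := hC
  upper := upper
  coarse_surj := surj
  lower a b := by
    rw [one_div, sub_le_iff_le_add, inv_mul_le_iff₀ (lt_of_lt_of_le one_pos hL)]
    exact lower a b

theorem mem_nbhd_image (h : IsQuasiIsometry L C q) {S : Set X} {T : Set Y}
    (hST : Near M (q '' S) T) {r : ℝ} {x : X} (hx : x ∈ nbhd r S) :
    q x ∈ nbhd (M + (L * r + C)) T := by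
  obtain ⟨a, ha, hax⟩ := hx
  refine nbhd_subset_nbhd hST.1 _ ⟨q a, ⟨a, ha, rfl⟩, (h.upper a x).trans ?_⟩
  have := mul_le_mul_of_nonneg_left hax (zero_le_one.trans h.one_le)
  linarith

theorem mem_nbhd_of_image (h : IsQuasiIsometry L C q) {S : Set X} {T : Set Y}
    (hST : Near M (q '' S) T) {r : ℝ} {x : X} (hx : q x ∈ nbhd r T) :
    x ∈ nbhd (L * (M + r + C)) S := by
  obtain ⟨_, ⟨a, ha, rfl⟩, hax⟩ := nbhd_subset_nbhd hST.2 r hx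
  refine ⟨a, ha, (h.dist_le a x).trans ?_⟩
  have := zero_le_one.trans h.one_le
  gcongr

theorem isBounded_of_image (h : IsQuasiIsometry L C q) {S : Set X}
    (hS : Bornology.IsBounded (q '' S)) : Bornology.IsBounded S := by
  obtain ⟨R, hR⟩ := Metric.isBounded_iff.1 hS
  refine Metric.isBounded_iff.2 ⟨L * (R + C), fun x hx y hy => (h.dist_le x y).trans ?_⟩
  have := zero_le_one.trans h.one_le
  have := hR ⟨x, hx, rfl⟩ ⟨y, hy, rfl⟩
  gcongr

theorem coarselyMeet (h : IsQuasiIsometry L C q) {ι : Type*} {S : ι → Set X} {T : ι → Set Y}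
    (hST : ∀ i, Near M (q '' S i) (T i)) (hS : CoarselyMeet S) : CoarselyMeet T := by
  obtain ⟨r, hr⟩ := hS
  refine ⟨M + (L * r + C), fun hb => hr (h.isBounded_of_image (hb.subset ?_))⟩
  rintro _ ⟨x, hx, rfl⟩
  exact Set.mem_iInter.2 fun i => h.mem_nbhd_image (hST i) (Set.mem_iInter.1 hx i)

theorem near_of_near_image (h : IsQuasiIsometry L C q) {S S' : Set X} {T T' : Set Y}
    (hS : Near M (q '' S) T) (hS' : Near M (q '' S') T') {r : ℝ} (hT : Near r T T') :
    Near (L * (M + (r + M) + C)) S S' := by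
  refine ⟨fun x hx => ?_, fun x hx => ?_⟩
  · exact h.mem_nbhd_of_image hS' (nbhd_subset_nbhd hT.1 M (hS.1 ⟨x, hx, rfl⟩))
  · exact h.mem_nbhd_of_image hS (nbhd_subset_nbhd hT.2 M (hS'.1 ⟨x, hx, rfl⟩))

theorem near_image (h : IsQuasiIsometry L C q) {S S' : Set X} {r : ℝ} (hS : Near r S S') :
    Near (L * r + C) (q '' S) (q '' S') := by
  have hL := zero_le_one.trans h.one_le
  have key : ∀ {S S' : Set X}, S ⊆ nbhd r S' → q '' S ⊆ nbhd (L * r + C) (q '' S') := by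
    rintro S S' hSS _ ⟨x, hx, rfl⟩
    obtain ⟨y, hy, hd⟩ := hSS hx
    refine ⟨q y, ⟨y, hy, rfl⟩, (h.upper y x).trans ?_⟩
    gcongr
  exact ⟨key hS.1, key hS.2⟩

/-- A coarse inverse of a quasi-isometry, with constants which control both compositions. -/
theorem exists_inverse (h : IsQuasiIsometry L C q) :
    ∃ p : Y → X, IsQuasiIsometry L (3 * L * C) p ∧ ∀ y, dist (q (p y)) y ≤ C := by
  choose p hp using h.coarse_surj
  have hL := zero_le_one.trans h.one_le
  have hC := h.nonneg
  have hLC : C ≤ L * C := le_mul_of_one_le_left hC h.one_le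
  refine ⟨p, .of_dist_le h.one_le (by positivity) (fun y z => ?_) (fun y z => ?_) (fun x => ?_), hp⟩
  · have h1 := h.upper (p y) (p z)
    have h2 := hp y
    have h3 := dist_triangle4 y (q (p y)) (q (p z)) z
    have h4 := hp z
    rw [dist_comm] at h2
    have h5 : L * C ≤ L * (L * C) := mul_le_mul_of_nonneg_left hLC hL
    rw [mul_add]
    nlinarith
  · have h1 := h.dist_le (p y) (p z)
    have h3 := dist_triangle4 (q (p y)) y z (q (p z))
    have h4 := hp y
    have h5 := hp z
    rw [dist_comm] at h5
    have h6 : dist (q (p y)) (q (p z)) + C ≤ dist y z + 3 * C := by linarith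
    have := mul_le_mul_of_nonneg_left h6 hL
    linarith
  · refine ⟨q x, (h.dist_le _ _).trans ?_⟩
    have := mul_le_mul_of_nonneg_left (hp (q x)) hL
    nlinarith

end IsQuasiIsometry

namespace IsQuasiIsometryOfPairs

variable {L C M : ℝ} {q : X → Y} {𝒜 : Set (Set X)} {ℬ : Set (Set Y)}

theorem of_near (h : IsQuasiIsometry L C q)
    (forth : ∀ A ∈ 𝒜, ∃ B ∈ ℬ, Near M (q '' A) B) (back : ∀ B ∈ ℬ, ∃ A ∈ 𝒜, Near M (q '' A) B) :
    IsQuasiIsometryOfPairs L C (|M| + 1) 𝒜 ℬ q where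
  quasiIsometry := h
  pos := by positivity
  forth A hA := by
    obtain ⟨B, hB, hAB⟩ := forth A hA
    exact ⟨B, hB, hAB.hausdorffEDist_lt (by linarith [le_abs_self M]) (by positivity)⟩
  back B hB := by
    obtain ⟨A, hA, hAB⟩ := back B hB
    exact ⟨A, hA, hAB.hausdorffEDist_lt (by linarith [le_abs_self M]) (by positivity)⟩

theorem exists_map (h : IsQuasiIsometryOfPairs L C M 𝒜 ℬ q) :
    ∃ f : Set X → Set Y, ∀ A ∈ 𝒜, f A ∈ ℬ ∧ Near M (q '' A) (f A) := by
  choose! f hf using h.forth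
  exact ⟨f, fun A hA => ⟨(hf A hA).1, .of_hausdorffEDist_lt (hf A hA).2⟩⟩

theorem exists_near_of_mem (h : IsQuasiIsometryOfPairs L C M 𝒜 ℬ q) {B : Set Y} (hB : B ∈ ℬ) :
    ∃ A ∈ 𝒜, Near M (q '' A) B := by
  obtain ⟨A, hA, hAB⟩ := h.back B hB
  exact ⟨A, hA, .of_hausdorffEDist_lt hAB⟩

/-- Being quasi-isometric is a symmetric relation on pairs. -/
theorem exists_inverse (h : IsQuasiIsometryOfPairs L C M 𝒜 ℬ q) :
    ∃ (L' C' M' : ℝ) (p : Y → X), IsQuasiIsometryOfPairs L' C' M' ℬ 𝒜 p := by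
  obtain ⟨p, hp, hqp⟩ := h.quasiIsometry.exists_inverse
  have hq := h.quasiIsometry
  have hL := zero_le_one.trans hq.one_le
  have key : ∀ A B, Near M (q '' A) B → Near (L * (C + M + C)) (p '' B) A := by
    intro A B hAB
    refine ⟨?_, fun a ha => ?_⟩
    · rintro _ ⟨b, hb, rfl⟩
      obtain ⟨_, ⟨a, ha, rfl⟩, hab⟩ := hAB.2 hb
      refine ⟨a, ha, (hq.dist_le _ _).trans ?_⟩
      have h1 := dist_triangle_right (q a) (q (p b)) b
      have h2 := hqp b
      gcongr
      linarith
    · obtain ⟨b, hb, hab⟩ := hAB.1 ⟨a, ha, rfl⟩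
      refine ⟨p b, ⟨b, hb, rfl⟩, (hq.dist_le _ _).trans ?_⟩
      have h1 := dist_triangle (q (p b)) b (q a)
      have h2 := hqp b
      gcongr
      linarith
  refine ⟨_, _, _, p, of_near (M := L * (C + M + C)) hp (fun B hB => ?_) (fun A hA => ?_)⟩
  · obtain ⟨A, hA, hAB⟩ := h.exists_near_of_mem hB
    exact ⟨A, hA, key A B hAB⟩
  · obtain ⟨f, hf⟩ := h.exists_map
    exact ⟨f A, (hf A hA).1, key A _ (hf A hA).2⟩

end IsQuasiIsometryOfPairs

/-- A finite family can be thinned out to one on which `f` is injective, at the cost of a factor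
bounding the fibres of `f`. -/
theorem exists_injective_comp {α β : Type*} {K m : ℕ} {𝒜 : Set α} {f : α → β}
    (hK : ∀ b, {a ∈ 𝒜 | f a = b}.encard ≤ K) {S : Fin m → α} (hS : ∀ i, S i ∈ 𝒜)
    (hinj : Function.Injective S) :
    ∃ (k : ℕ) (e : Fin k → Fin m), Function.Injective (f ∘ S ∘ e) ∧ m ≤ K * k := by
  classical
  let t : Finset β := Finset.univ.image (f ∘ S)
  have ht : ∀ b : t, ∃ i, f (S i) = b := fun b => by
    obtain ⟨i, -, hi⟩ := Finset.mem_image.1 b.2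
    exact ⟨i, hi⟩
  choose g hg using ht
  refine ⟨t.card, g ∘ t.equivFin.symm, fun i j hij => ?_, ?_⟩
  · simp only [Function.comp_apply, hg] at hij
    exact t.equivFin.symm.injective (Subtype.ext hij)
  · have := Finset.card_le_mul_card_image (f := f ∘ S) (Finset.univ : Finset (Fin m)) K
      (fun b _ => ?_)
    · simpa using this
    · rw [← Nat.cast_le (α := ℕ∞), ← Set.encard_coe_eq_coe_finsetCard]
      refine le_trans (Set.encard_le_encard_of_injOn (f := S) ?_ hinj.injOn) (hK b)
      intro i hi
      exact ⟨hS i, by simpa using hi⟩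

/-- A bound on the size of distinct families in `ℬ` with a property `Ψ` yields one for families
in `𝒜` with a property `Φ`, if `f` takes `Φ` to `Ψ` and has uniformly finite fibres. -/
theorem exists_card_le_of_map {α β : Type*} {𝒜 : Set α} {ℬ : Set β} {f : α → β} {K : ℕ}
    (hK : ∀ T, {A ∈ 𝒜 | f A = T}.encard ≤ K)
    (hf : ∀ A ∈ 𝒜, f A ∈ ℬ) {Φ : ∀ m : ℕ, (Fin m → α) → Prop}
    {Ψ : ∀ m : ℕ, (Fin m → β) → Prop}
    (hΦ : ∀ m k (S : Fin m → α) (e : Fin k → Fin m), (∀ i, S i ∈ 𝒜) →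
      Function.Injective (f ∘ S ∘ e) → Φ m S → Ψ k (f ∘ S ∘ e))
    (hΨ : ∃ N : ℕ, ∀ m (T : Fin m → β), (∀ i, T i ∈ ℬ) → Function.Injective T → Ψ m T → m ≤ N) :
    ∃ N : ℕ, ∀ m (S : Fin m → α), (∀ i, S i ∈ 𝒜) → Function.Injective S → Φ m S → m ≤ N := by
  obtain ⟨N, hN⟩ := hΨ
  refine ⟨K * N, fun m S hS hinj hΦS => ?_⟩
  obtain ⟨k, e, he, hm⟩ := exists_injective_comp hK hS hinj
  exact hm.trans (Nat.mul_le_mul_left K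
    (hN k _ (fun i => hf _ (hS _)) he (hΦ m k S e hS he hΦS)))

section Transport

variable {L C M : ℝ} {q : X → Y} {𝒜 : Set (Set X)} {ℬ : Set (Set Y)} {f : Set X → Set Y}

/-- Members of `𝒜` with the same image are uniformly close to each other, so they all meet a ball
of fixed radius. -/
theorem exists_encard_fiber_le (hq : IsQuasiIsometry L C q)
    (hf : ∀ A ∈ 𝒜, f A ∈ ℬ ∧ Near M (q '' A) (f A)) (h𝒜 : UniformlyLocallyFinite 𝒜)
    (hne : ∀ A ∈ 𝒜, A.Nonempty) : ∃ K : ℕ, ∀ T, {A ∈ 𝒜 | f A = T}.encard ≤ K := by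
  obtain ⟨K, hK⟩ := h𝒜 (L * (M + (0 + M) + C))
  refine ⟨K, fun T => ?_⟩
  rcases Set.eq_empty_or_nonempty {A ∈ 𝒜 | f A = T} with h0 | ⟨A, hA, hAT⟩
  · simp [h0]
  obtain ⟨x, hx⟩ := hne A hA
  refine (Set.encard_le_encard ?_).trans (hK x)
  rintro A' ⟨hA', hAT'⟩
  refine ⟨hA', (hq.near_of_near_image (hf A hA).2 (hf A' hA').2 ?_).1 hx⟩
  rw [hAT, hAT']
  exact Near.refl le_rfl T

theorem setDist_lt_of_near (hq : IsQuasiIsometry L C q) {S S' : Set X} {T T' : Set Y}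
    (hS : Near M (q '' S) T) (hS' : Near M (q '' S') T') (hne : S.Nonempty) (hne' : S'.Nonempty)
    {D : ℝ} (hD : setDist S S' < D) : setDist T T' < L * D + C + 2 * M + 1 := by
  obtain ⟨a, ha, b, hb, hab⟩ := (setDist_lt_iff hne hne').1 hD
  obtain ⟨t, ht, hat⟩ := hS.1 ⟨a, ha, rfl⟩
  obtain ⟨u, hu, hbu⟩ := hS'.1 ⟨b, hb, rfl⟩
  refine (setDist_lt_iff ⟨t, ht⟩ ⟨u, hu⟩).2 ⟨t, ht, u, hu, ?_⟩
  have h1 := dist_triangle4 t (q a) (q b) u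
  have h2 := hq.upper a b
  have h3 := mul_le_mul_of_nonneg_left hab.le (zero_le_one.trans hq.one_le)
  rw [dist_comm u] at hbu
  linarith

theorem setDist_lt_of_near_image (hq : IsQuasiIsometry L C q) {S S' : Set X} {T T' : Set Y}
    (hS : Near M (q '' S) T) (hS' : Near M (q '' S') T') (hne : T.Nonempty) (hne' : T'.Nonempty)
    {D : ℝ} (hD : setDist T T' < D) : setDist S S' < L * (D + 2 * M + C) + 1 := by
  obtain ⟨t, ht, u, hu, htu⟩ := (setDist_lt_iff hne hne').1 hD
  obtain ⟨_, ⟨a, ha, rfl⟩, hat⟩ := hS.2 ht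
  obtain ⟨_, ⟨b, hb, rfl⟩, hbu⟩ := hS'.2 hu
  refine (setDist_lt_iff ⟨a, ha⟩ ⟨b, hb⟩).2 ⟨a, ha, b, hb, ?_⟩
  have h1 := dist_triangle4 (q a) t u (q b)
  rw [dist_comm] at hbu
  have h2 : dist (q a) (q b) + C ≤ D + 2 * M + C := by linarith
  have h3 := mul_le_mul_of_nonneg_left h2 (zero_le_one.trans hq.one_le)
  linarith [hq.dist_le a b]

/-- A quasi-isometry of pairs preserves networks. The constants grow, and a chain joining members
of `𝒜` gives one for `ℬ`, prolonged by one step at both ends because a member of `ℬ` need not be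
the chosen image of a member of `𝒜`. -/
theorem IsNetworkWith.of_quasiIsometryOfPairs (h : IsQuasiIsometryOfPairs L C M 𝒜 ℬ q)
    (hunb : ∀ A ∈ 𝒜, ¬ Bornology.IsBounded A) {τ : ℝ} (hτ : 0 ≤ τ) (h𝒜 : IsNetworkWith τ 𝒜) :
    ∃ σ : ℝ, 0 ≤ σ ∧ IsNetworkWith σ ℬ := by
  have hq := h.quasiIsometry
  have hL := zero_le_one.trans hq.one_le
  have hC := hq.nonneg
  have hM := h.pos
  obtain ⟨f, hf⟩ := h.exists_map
  refine ⟨M + (L * τ + C) + C, by positivity, fun y => ?_, fun B hB B' hB' => ?_⟩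
  · obtain ⟨x, hx⟩ := hq.coarse_surj y
    obtain ⟨A, hA, hxA⟩ := h𝒜.1 x
    refine ⟨f A, (hf A hA).1, ?_⟩
    obtain ⟨b, hb, hbx⟩ := hq.mem_nbhd_image (hf A hA).2 hxA
    exact ⟨b, hb, (dist_triangle b (q x) y).trans (add_le_add hbx hx)⟩
  obtain ⟨A, hA, hAB⟩ := h.exists_near_of_mem hB
  obtain ⟨A', hA', hAB'⟩ := h.exists_near_of_mem hB'
  obtain ⟨n, S, hS0, hSn, hS, hSS⟩ := h𝒜.2 A hA A' hA'
  let T : ℕ → Set Y := fun i => if i = 0 then B else if i = n + 2 then B' else f (S (i - 1))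
  have hT : ∀ i ≤ n + 2, T i ∈ ℬ ∧ Near M (q '' S (min (i - 1) n)) (T i) := by
    intro i hi
    by_cases h0 : i = 0
    · subst h0
      simp only [T, if_pos]
      exact ⟨hB, by simpa [hS0] using hAB⟩
    by_cases h1 : i = n + 2
    · subst h1
      simp only [T, if_neg h0, if_pos]
      exact ⟨hB', by rw [min_eq_right (by omega), hSn]; exact hAB'⟩
    · simp only [T, if_neg h0, if_neg h1]
      rw [min_eq_left (by omega)]
      exact hf _ (hS _ (by omega))
  refine ⟨n + 2, T, by simp [T], by simp [T], fun i hi => (hT i hi).1, fun i hi hb => ?_⟩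
  -- Consecutive members of the prolonged chain come from the same or from consecutive `S j`.
  have hSi : ¬ Bornology.IsBounded
      (nbhd τ (S (min (i - 1) n)) ∩ nbhd τ (S (min (i + 1 - 1) n))) := by
    by_cases hc : 1 ≤ i ∧ i ≤ n
    · have := hSS (i - 1) (by omega)
      rwa [min_eq_left (by omega), min_eq_left (by omega), show i + 1 - 1 = i - 1 + 1 by omega]
    · rw [show min (i + 1 - 1) n = min (i - 1) n by omega, Set.inter_self]
      exact fun hb => hunb _ (hS _ (min_le_right _ _)) (hb.subset (subset_nbhd hτ _))
  refine hSi (hq.isBounded_of_image (hb.subset ?_))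
  rintro _ ⟨x, ⟨hx, hx'⟩, rfl⟩
  exact ⟨nbhd_mono (le_add_of_nonneg_right hC) _ (hq.mem_nbhd_image (hT i hi.le).2 hx),
    nbhd_mono (le_add_of_nonneg_right hC) _ (hq.mem_nbhd_image (hT (i + 1) hi).2 hx')⟩

end Transport

end Coarse

/-! ### Asymptotic cones and thickness of order zero under quasi-isometries -/

theorem IsCutPoint.of_homeomorph {X Y : Type*} [TopologicalSpace X] [TopologicalSpace Y]
    (e : X ≃ₜ Y) {x : X} (hx : IsCutPoint x) : IsCutPoint (e x) := by
  obtain ⟨y, z, hy, hz, hyz⟩ := hx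
  refine ⟨e y, e z, e.injective.ne hy, e.injective.ne hz, fun h => hyz ?_⟩
  have := h.map e.symm.continuous
  simp only [e.symm_apply_apply] at this
  refine this.mono ?_
  rintro _ ⟨w, hw, rfl⟩
  intro hwx
  exact hw (by rw [Set.mem_singleton_iff, ← Set.mem_singleton_iff.1 hwx, e.apply_symm_apply])

/-- A map of pseudometric spaces which is bi-Lipschitz, and surjective up to distance zero, induces
a homeomorphism of the associated metric spaces. -/
theorem nonempty_homeomorph_separationQuotient {X Y : Type*} [PseudoMetricSpace X]
    [PseudoMetricSpace Y] {L : ℝ} (hL : 0 ≤ L) {f : X → Y}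
    (hlower : ∀ x y, dist x y ≤ L * dist (f x) (f y))
    (hupper : ∀ x y, dist (f x) (f y) ≤ L * dist x y) (hsurj : ∀ y, ∃ x, dist (f x) y = 0) :
    Nonempty (SeparationQuotient X ≃ₜ SeparationQuotient Y) := by
  have hf : LipschitzWith ⟨L, hL⟩ f := LipschitzWith.of_dist_le_mul hupper
  have hlift : ∀ x y : X, Inseparable x y →
      SeparationQuotient.mk (f x) = SeparationQuotient.mk (f y) := fun x y hxy =>
    SeparationQuotient.mk_eq_mk.2 (hxy.map hf.continuous)
  let F : SeparationQuotient X → SeparationQuotient Y :=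
    SeparationQuotient.lift (SeparationQuotient.mk ∘ f) hlift
  have hF : ∀ x, F (SeparationQuotient.mk x) = SeparationQuotient.mk (f x) := fun x => rfl
  have hFL : LipschitzWith ⟨L, hL⟩ F := LipschitzWith.of_dist_le_mul fun a b => by
    obtain ⟨x, rfl⟩ := SeparationQuotient.surjective_mk a
    obtain ⟨y, rfl⟩ := SeparationQuotient.surjective_mk b
    rw [hF, hF, SeparationQuotient.dist_mk, SeparationQuotient.dist_mk]
    exact hupper x y
  have hFA : AntilipschitzWith ⟨L, hL⟩ F := AntilipschitzWith.of_le_mul_dist fun a b => by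
    obtain ⟨x, rfl⟩ := SeparationQuotient.surjective_mk a
    obtain ⟨y, rfl⟩ := SeparationQuotient.surjective_mk b
    rw [hF, hF, SeparationQuotient.dist_mk, SeparationQuotient.dist_mk]
    exact hlower x y
  refine ⟨(hFA.isUniformEmbedding hFL.uniformContinuous).isEmbedding.toHomeomorphOfSurjective ?_⟩
  intro b
  obtain ⟨y, rfl⟩ := SeparationQuotient.surjective_mk b
  obtain ⟨x, hx⟩ := hsurj y
  exact ⟨SeparationQuotient.mk x, SeparationQuotient.mk_eq_mk.2 (Metric.inseparable_iff.2 hx)⟩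

section Cone

variable {ω : Ultrafilter ℕ} {d : ℕ → ℝ≥0} {A B : ℕ → Type*} [∀ i, PseudoMetricSpace (A i)]
  [∀ i, PseudoMetricSpace (B i)] {a : ∀ i, A i} {b : ∀ i, B i} {L C : ℝ} {p : ∀ i, A i → B i}

/-- Additive constants vanish after rescaling. -/
theorem tendsto_const_div_scale (hd : Filter.Tendsto d (ω : Filter ℕ) Filter.atTop) (C : ℝ) :
    Filter.Tendsto (fun i => C / (d i : ℝ)) (ω : Filter ℕ) (𝓝 0) :=
  (NNReal.tendsto_coe_atTop.2 hd).const_div_atTop C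

/-- Uniform quasi-isometries which take base points close to base points induce a homeomorphism of
asymptotic cones. -/
theorem nonempty_homeomorph_cone (hd : Filter.Tendsto d (ω : Filter ℕ) Filter.atTop)
    (hp : ∀ i, IsQuasiIsometry L C (p i)) (hab : ∀ i, dist (p i (a i)) (b i) ≤ C) :
    Nonempty (Cone ω d A a ≃ₜ Cone ω d B b) := by
  have hL : 0 ≤ L := zero_le_one.trans (hp 0).one_le
  have hdC : ∀ C : ℝ, ∀ᶠ i in (ω : Filter ℕ), C / (d i : ℝ) ≤ 1 := fun C =>
    (tendsto_const_div_scale hd C).eventually_le_const one_pos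
  have hbdd : ∀ x : ConeSeq ω d A a,
      ∃ r : ℝ, ∀ᶠ i in (ω : Filter ℕ), dist (p i (x.1 i)) (b i) / d i ≤ r := by
    intro x
    obtain ⟨r, hr⟩ := x.2
    refine ⟨L * r + 1, ?_⟩
    filter_upwards [hr, hdC (C + C)] with i h1 h2
    calc dist (p i (x.1 i)) (b i) / (d i : ℝ)
        ≤ (L * dist (x.1 i) (a i) + (C + C)) / d i := by
          gcongr
          linarith [dist_triangle (p i (x.1 i)) (p i (a i)) (b i), (hp i).upper (x.1 i) (a i), hab i]
      _ = L * (dist (x.1 i) (a i) / d i) + (C + C) / d i := by rw [add_div, mul_div_assoc]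
      _ ≤ L * r + 1 := by gcongr
  let f : ConeSeq ω d A a → ConeSeq ω d B b := fun x => ⟨fun i => p i (x.1 i), hbdd x⟩
  refine nonempty_homeomorph_separationQuotient hL (f := f) (fun x y => ?_) (fun x y => ?_)
    (fun y => ?_)
  · have h1 := ((tendsto_coneDist (f x) (f y)).const_mul L).add (tendsto_const_div_scale hd (L * C))
    rw [add_zero] at h1
    refine le_of_tendsto_of_tendsto' (tendsto_coneDist x y) h1 fun i => ?_
    rw [← mul_div_assoc, ← add_div, ← mul_add]
    gcongr
    exact (hp i).dist_le _ _
  · have h1 := ((tendsto_coneDist x y).const_mul L).add (tendsto_const_div_scale hd C)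
    rw [add_zero] at h1
    refine le_of_tendsto_of_tendsto' (tendsto_coneDist (f x) (f y)) h1 fun i => ?_
    rw [← mul_div_assoc, ← add_div]
    gcongr
    exact (hp i).upper _ _
  · choose x hx using fun i => (hp i).coarse_surj (y.1 i)
    have hxb : ∃ r : ℝ, ∀ᶠ i in (ω : Filter ℕ), dist (x i) (a i) / d i ≤ r := by
      obtain ⟨r, hr⟩ := y.2
      refine ⟨L * (r + 1), ?_⟩
      filter_upwards [hr, hdC (C + C + C)] with i h1 h2
      calc dist (x i) (a i) / (d i : ℝ)
          ≤ L * (dist (y.1 i) (b i) + (C + C + C)) / d i := by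
            gcongr
            refine ((hp i).dist_le _ _).trans (mul_le_mul_of_nonneg_left ?_ hL)
            have h3 := dist_triangle4 (p i (x i)) (y.1 i) (b i) (p i (a i))
            have h4 := hab i
            rw [dist_comm] at h4
            linarith [hx i]
        _ = L * (dist (y.1 i) (b i) / d i + (C + C + C) / d i) := by rw [← add_div, mul_div_assoc]
        _ ≤ L * (r + 1) := by gcongr
    refine ⟨⟨x, hxb⟩, le_antisymm ?_ dist_nonneg⟩
    refine le_of_tendsto_of_tendsto' (tendsto_coneDist (f ⟨x, hxb⟩) y)
      (tendsto_const_div_scale hd C) fun i => ?_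
    gcongr
    exact hx i

end Cone

section Thick

variable {X Y : Type*} [PseudoMetricSpace X] [PseudoMetricSpace Y]

/-- Thickness of order zero passes to collections whose members are uniformly quasi-isometric to
members of the given collection. -/
theorem UniformlyThickZero.of_quasiIsometry {L C : ℝ} {𝒴 : Set (Set X)} {𝒵 : Set (Set Y)}
    (h : UniformlyThickZero 𝒴)
    (hp : ∀ Z ∈ 𝒵, ∃ Y ∈ 𝒴, ∃ p : Y → Z, IsQuasiIsometry L C p) : UniformlyThickZero 𝒵 := by
  rcases 𝒵.eq_empty_or_nonempty with rfl | ⟨Z₀, hZ₀⟩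
  · exact ⟨⟨1, 0, 0, le_rfl, le_rfl, le_rfl, by simp⟩, fun B hB => (hB 0).elim⟩
  obtain ⟨_, _, _, hp₀⟩ := hp Z₀ hZ₀
  have hL1 : 1 ≤ L := hp₀.one_le
  have hL : 0 ≤ L := zero_le_one.trans hL1
  have hC : 0 ≤ C := hp₀.nonneg
  refine ⟨?_, fun B hB => ?_⟩
  · obtain ⟨l, k, c, hl, hk, hc, H⟩ := h.1
    have hl0 : 0 < l := lt_of_lt_of_le one_pos hl
    refine ⟨L * l, L * k + C, L * c + C + C, one_le_mul_of_one_le_of_one_le hL1 hl, by positivity,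
      by positivity, fun Z hZ z => ?_⟩
    obtain ⟨Y, hY, p, hp⟩ := hp Z hZ
    obtain ⟨y, hy⟩ := hp.coarse_surj z
    obtain ⟨γ, hγ, t, ht⟩ := H Y hY y
    refine ⟨p ∘ γ, fun s t => ⟨?_, ?_⟩, t, ?_⟩
    · refine le_trans ?_ (hp.lower _ _)
      have h1 : 1 / L * (1 / l * |s - t| - k) ≤ 1 / L * dist (γ s) (γ t) := by
        have := (hγ s t).1
        gcongr
      have h2 : 1 / L * k ≤ L * k := by
        gcongr
        exact (div_le_one_of_le₀ hL1 hL).trans hL1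
      have h3 : 1 / (L * l) * |s - t| = 1 / L * (1 / l * |s - t|) := by
        rw [← mul_assoc, one_div_mul_one_div]
      rw [h3]
      linarith
    · refine (hp.upper _ _).trans ?_
      have := mul_le_mul_of_nonneg_left (hγ s t).2 hL
      linarith
    · have h1 := dist_triangle_left z (p (γ t)) (p y)
      have h2 := (hp.upper y (γ t)).trans (add_le_add_left (mul_le_mul_of_nonneg_left ht hL) C)
      simp only [Function.comp_apply]
      linarith
  -- The ultrafilter and the scaling constants of a sequence of members of `𝒴` serve for `B`, since
  -- they are given before the base points.
  · choose A hA p hp using fun i => hp (B i) (hB i)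
    obtain ⟨ω, d, hω, hd0, hd, hcut⟩ := h.2 A hA
    refine ⟨ω, d, hω, hd0, hd, fun b x hx => ?_⟩
    choose a ha using fun i => (hp i).coarse_surj (b i)
    obtain ⟨e⟩ := nonempty_homeomorph_cone hd hp ha
    exact hcut a _ (hx.of_homeomorph e.symm)

/-- A quasi-isometry restricts to a quasi-isometry between subsets that it makes correspond up to
bounded distance. -/
theorem IsQuasiIsometry.exists_restrict {L C M : ℝ} {q : X → Y} (h : IsQuasiIsometry L C q)
    (hM : 0 ≤ M) {A : Set X} {B : Set Y} (hAB : Near M (q '' A) B) :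
    ∃ p : A → B, IsQuasiIsometry L (C + 2 * M) p := by
  have hp : ∀ a : A, ∃ b : B, dist (b : Y) (q a) ≤ M := fun a => by
    obtain ⟨b, hb, hd⟩ := hAB.1 ⟨a, a.2, rfl⟩
    exact ⟨⟨b, hb⟩, hd⟩
  choose p hp using hp
  have hL := zero_le_one.trans h.one_le
  refine ⟨p, .of_dist_le h.one_le (by linarith [h.nonneg]) (fun a a' => ?_) (fun a a' => ?_)
    (fun b => ?_)⟩
  · refine (h.dist_le a a').trans (mul_le_mul_of_nonneg_left ?_ hL)
    have h2 := hp a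
    have h3 := hp a'
    have h4 := dist_triangle4 (q a) (p a : Y) (p a' : Y) (q a')
    rw [dist_comm] at h2
    rw [Subtype.dist_eq]
    linarith
  · have h1 := h.upper a a'
    have h2 := hp a
    have h3 := hp a'
    have h4 := dist_triangle4 (p a : Y) (q a) (q a') (p a' : Y)
    rw [dist_comm] at h3
    rw [Subtype.dist_eq, Subtype.dist_eq]
    linarith
  · obtain ⟨_, ⟨a, ha, rfl⟩, hd⟩ := hAB.2 b.2
    refine ⟨⟨a, ha⟩, ?_⟩
    have h1 := dist_triangle (p ⟨a, ha⟩ : Y) (q a) b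
    have h2 := hp ⟨a, ha⟩
    rw [Subtype.dist_eq]
    linarith [h.nonneg]

theorem UniformlyThickZero.of_quasiIsometryOfPairs {L C M : ℝ} {q : X → Y} {𝒜 : Set (Set X)}
    {ℬ : Set (Set Y)} (h : IsQuasiIsometryOfPairs L C M 𝒜 ℬ q) (h𝒜 : UniformlyThickZero 𝒜) :
    UniformlyThickZero ℬ := by
  refine h𝒜.of_quasiIsometry (L := L) (C := C + 2 * M) fun B hB => ?_
  obtain ⟨A, hA, hAB⟩ := h.exists_near_of_mem hB
  exact ⟨A, hA, h.quasiIsometry.exists_restrict h.pos.le hAB⟩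

theorem ThickZero.of_quasiIsometry {L C : ℝ} {q : X → Y} (h : IsQuasiIsometry L C q)
    (hX : ThickZero X) : ThickZero Y := by
  refine UniformlyThickZero.of_quasiIsometry (L := L) (C := C + 2 * C) hX fun B hB => ?_
  refine ⟨Set.univ, rfl, h.exists_restrict h.nonneg ?_⟩
  rw [Set.mem_singleton_iff.1 hB]
  refine ⟨fun y _ => ⟨y, trivial, by simpa using h.nonneg⟩, fun y _ => ?_⟩
  obtain ⟨x, hx⟩ := h.coarse_surj y
  exact ⟨q x, ⟨x, trivial, rfl⟩, hx⟩

end Thick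

/-! ### The word metric and cosets -/

theorem finite_isWordOfLength {G : Type*} [Group G] {S : Set G} (hS : S.Finite) (n : ℕ) :
    {g | IsWordOfLength S n g}.Finite := by
  induction n with
  | zero =>
    refine (Set.finite_singleton (1 : G)).subset ?_
    rintro g ⟨l, hl, -, rfl⟩
    rw [List.length_eq_zero_iff.1 hl]
    simp
  | succ n ih =>
    refine ((hS.union hS.inv).mul ih).subset ?_
    rintro g ⟨l, hl, hlS, rfl⟩
    obtain ⟨s, l, rfl⟩ := List.exists_cons_of_length_eq_add_one hl
    rw [List.prod_cons]
    exact Set.mul_mem_mul (hlS s (by simp))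
      ⟨l, by simpa using hl, fun t ht => hlS t (by simp [ht]), rfl⟩

theorem smul_coe_eq_of_mem {G : Type*} [Group G] {P : Subgroup G} {g x : G}
    (hx : x ∈ g • (P : Set G)) : x • (P : Set G) = g • (P : Set G) := by
  rw [Set.mem_smul_set_iff_inv_smul_mem, smul_eq_mul, SetLike.mem_coe] at hx
  ext y
  simp only [Set.mem_smul_set_iff_inv_smul_mem, smul_eq_mul, SetLike.mem_coe]
  rw [← P.mul_mem_cancel_left hx]
  simp [mul_assoc]

namespace GroupPair

variable {A B : GroupPair.{u}}

theorem mem_conj_iff {G : Type*} [Group G] {g x : G} {P : Subgroup G} :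
    x ∈ conj g P ↔ g⁻¹ * x * g ∈ P := by
  rw [Subgroup.mem_pointwise_smul_iff_inv_smul_mem, ← ConjAct.toConjAct_inv,
    ConjAct.toConjAct_inv_smul]

theorem conj_mul {G : Type*} [Group G] (g h : G) (P : Subgroup G) :
    conj (g * h) P = conj g (conj h P) := by
  simp only [conj, ConjAct.toConjAct_mul, mul_smul]

theorem dist_mul_left (g h k : A.G) : dist (g * h) (g * k) = dist h k := by
  change (wordLength A.gens ((g * h)⁻¹ * (g * k)) : ℝ) = wordLength A.gens (h⁻¹ * k)
  group

theorem finite_ball (A : GroupPair.{u}) (r : ℝ) : {g : A.G | dist 1 g ≤ r}.Finite := by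
  refine (Set.Finite.biUnion (Set.finite_Iic ⌊r⌋₊) fun n _ =>
    finite_isWordOfLength A.gens_finite n).subset fun g hg => ?_
  have h1 : (wordLength A.gens (1⁻¹ * g) : ℝ) ≤ r := hg
  rw [inv_one, one_mul] at h1
  exact Set.mem_biUnion (Nat.le_floor h1) (isWordOfLength_wordLength A.gens_closure g)

theorem isBounded_iff_finite {S : Set A.G} : Bornology.IsBounded S ↔ S.Finite := by
  refine ⟨fun h => ?_, fun h => h.isBounded⟩
  obtain ⟨r, hr⟩ := h.subset_closedBall 1
  exact (A.finite_ball r).subset fun g hg => by simpa [dist_comm] using hr hg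

theorem mem_nbhd_iff {r : ℝ} {S : Set A.G} {x : A.G} :
    x ∈ nbhd r S ↔ ∃ u, dist 1 u ≤ r ∧ x * u ∈ S := by
  have key : ∀ u : A.G, dist (x * u) x = dist 1 u := fun u => by
    rw [dist_comm]
    simpa using dist_mul_left x 1 u
  constructor
  · rintro ⟨a, ha, hd⟩
    exact ⟨x⁻¹ * a, by rw [← key]; simpa using hd, by simpa using ha⟩
  · rintro ⟨u, hu, hS⟩
    exact ⟨x * u, hS, by rwa [key]⟩

theorem mem_nbhd_smul {r : ℝ} {S : Set A.G} {g x : A.G} :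
    g * x ∈ nbhd r (g • S) ↔ x ∈ nbhd r S := by
  simp [mem_nbhd_iff, mul_assoc, Set.mem_smul_set_iff_inv_smul_mem]

theorem near_smul_smul {r : ℝ} {S T : Set A.G} (h : Near r S T) (g : A.G) : Near r (g • S) (g • T) := by
  refine ⟨?_, ?_⟩
  · rintro _ ⟨x, hx, rfl⟩
    exact mem_nbhd_smul.2 (h.1 hx)
  · rintro _ ⟨x, hx, rfl⟩
    exact mem_nbhd_smul.2 (h.2 hx)

theorem nonempty_of_mem_cosets {S : Set A.G} (hS : S ∈ A.cosets) : S.Nonempty := by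
  obtain ⟨g, P, -, rfl⟩ := hS
  exact ⟨g • (1 : A.G), 1, P.one_mem, rfl⟩

theorem not_isBounded_of_mem_cosets {S : Set A.G} (hS : S ∈ A.cosets) :
    ¬ Bornology.IsBounded S := by
  obtain ⟨g, P, hP, rfl⟩ := hS
  rw [isBounded_iff_finite, Set.finite_smul_set]
  exact A.periph_infinite P hP

theorem finite_cosets_mem_nbhd (A : GroupPair.{u}) (r : ℝ) :
    {S ∈ A.cosets | 1 ∈ nbhd r S}.Finite := by
  refine (((A.finite_ball r).prod A.periph_finite).image
    fun p : A.G × Subgroup A.G => p.1 • (p.2 : Set A.G)).subset ?_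
  rintro S ⟨⟨g, P, hP, rfl⟩, hx⟩
  obtain ⟨u, hu, hxu⟩ := mem_nbhd_iff.1 hx
  rw [one_mul] at hxu
  exact ⟨(u, P), ⟨hu, hP⟩, smul_coe_eq_of_mem hxu⟩

theorem smul_mem_cosets {S : Set A.G} (hS : S ∈ A.cosets) (g : A.G) : g • S ∈ A.cosets := by
  obtain ⟨h, P, hP, rfl⟩ := hS
  exact ⟨g * h, P, hP, by rw [mul_smul]⟩

theorem uniformlyLocallyFinite_cosets (A : GroupPair.{u}) : UniformlyLocallyFinite A.cosets := by
  intro r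
  have hfin := A.finite_cosets_mem_nbhd r
  refine ⟨hfin.toFinset.card, fun x => ?_⟩
  rw [← hfin.encard_eq_coe_toFinset_card]
  refine Set.encard_le_encard_of_injOn (f := fun S => x⁻¹ • S) ?_
    (MulAction.injective (x⁻¹ : A.G)).injOn
  rintro S ⟨hS, hx⟩
  refine ⟨smul_mem_cosets hS _, ?_⟩
  simpa using (mem_nbhd_smul (g := x⁻¹)).2 hx

/-! ### Intersections of conjugates, commensurability and finite index in metric terms -/

/-- A coset and the corresponding conjugate are at finite Hausdorff distance. -/
theorem near_smul_conj (g : A.G) (P : Subgroup A.G) :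
    Near (dist 1 g + dist 1 g⁻¹) (g • (P : Set A.G)) (conj g P : Set A.G) := by
  refine ⟨fun x hx => mem_nbhd_iff.2 ⟨g⁻¹, le_add_of_nonneg_left dist_nonneg, ?_⟩,
    fun x hx => mem_nbhd_iff.2 ⟨g, le_add_of_nonneg_right dist_nonneg, ?_⟩⟩
  · rw [SetLike.mem_coe, mem_conj_iff]
    simpa [Set.mem_smul_set_iff_inv_smul_mem, mul_assoc] using hx
  · rw [SetLike.mem_coe, mem_conj_iff] at hx
    simpa [Set.mem_smul_set_iff_inv_smul_mem, mul_assoc] using hx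

/-- The intersection of finitely many conjugates `gᵢPᵢgᵢ⁻¹` is infinite if and only if the cosets
`gᵢPᵢ` have coarsely unbounded intersection. If infinitely many `x` are close to all the cosets, then
by the pigeonhole principle infinitely many are so via the same displacements `uᵢ`, with
`x * uᵢ ∈ gᵢPᵢ`, and the quotients `x * x₀⁻¹` of two of those lie in all the conjugates. -/
theorem infinite_iInf_conj_iff {ι : Type*} [Finite ι] (g : ι → A.G) (P : ι → Subgroup A.G) :
    ((⨅ i, conj (g i) (P i) : Subgroup A.G) : Set A.G).Infinite ↔
      CoarselyMeet fun i => g i • (P i : Set A.G) := by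
  cases nonempty_fintype ι
  constructor
  · intro h
    refine ⟨∑ i, (dist 1 (g i) + dist 1 (g i)⁻¹), fun hb =>
      h ((isBounded_iff_finite.1 hb).subset fun x hx => Set.mem_iInter.2 fun i => ?_)⟩
    refine nbhd_mono (Finset.single_le_sum (fun j _ => by positivity) (Finset.mem_univ i)) _
      ((near_smul_conj (g i) (P i)).2 ?_)
    exact (Subgroup.mem_iInf.1 hx) i
  · rintro ⟨r, hr⟩ hfin
    have hu : ∀ x ∈ ⋂ i, nbhd r (g i • (P i : Set A.G)), ∃ u : ι → A.G,
        ∀ i, dist 1 (u i) ≤ r ∧ x * u i ∈ g i • (P i : Set A.G) := fun x hx => by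
      choose u hu using fun i => mem_nbhd_iff.1 (Set.mem_iInter.1 hx i)
      exact ⟨u, hu⟩
    choose! u hu using hu
    refine hr (isBounded_iff_finite.2 (Set.Finite.of_finite_fibers u ?_ fun v _ => ?_))
    · refine (Set.Finite.pi' fun _ : ι => A.finite_ball r).subset ?_
      rintro _ ⟨x, hx, rfl⟩ i
      exact (hu x hx i).1
    · rcases Set.eq_empty_or_nonempty
        ((⋂ i, nbhd r (g i • (P i : Set A.G))) ∩ u ⁻¹' {v}) with h0 | ⟨x₀, hx₀, rfl⟩
      · rw [h0]
        exact Set.finite_empty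
      refine Set.Finite.of_injOn (f := fun x => x * x₀⁻¹) ?_ (mul_left_injective _).injOn hfin
      rintro x ⟨hx, hxu⟩
      refine Subgroup.mem_iInf.2 fun i => mem_conj_iff.2 ?_
      have h1 := (hu x hx i).2
      have h2 := (hu x₀ hx₀ i).2
      rw [show u x = u x₀ from hxu] at h1
      rw [Set.mem_smul_set_iff_inv_smul_mem, smul_eq_mul, SetLike.mem_coe] at h1 h2
      simpa [mul_assoc] using (P i).mul_mem h1 ((P i).inv_mem h2)

/-- `K` is contained in a neighbourhood of `H` if and only if `H ∩ K` has finite index in `K`. -/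
theorem relIndex_ne_zero_iff_subset_nbhd (H K : Subgroup A.G) :
    H.relIndex K ≠ 0 ↔ ∃ r, (K : Set A.G) ⊆ nbhd r (H : Set A.G) := by
  constructor
  · intro h
    have : (H.subgroupOf K).FiniteIndex := ⟨h⟩
    have : Fintype (K ⧸ H.subgroupOf K) := Fintype.ofFinite _
    refine ⟨∑ c : K ⧸ H.subgroupOf K, dist 1 (c.out : A.G), fun k hk => ?_⟩
    -- Inverses turn left cosets of `H ∩ K` into right cosets, whose elements are close to `H`.
    let c : K ⧸ H.subgroupOf K := ((⟨k, hk⟩ : K)⁻¹ : K)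
    refine mem_nbhd_iff.2 ⟨c.out, Finset.single_le_sum (f := fun c : K ⧸ H.subgroupOf K =>
      dist 1 (c.out : A.G)) (fun j _ => dist_nonneg) (Finset.mem_univ c), ?_⟩
    have h1 : (((⟨k, hk⟩ : K)⁻¹ : K) : K ⧸ H.subgroupOf K) = (c.out : K) := by
      rw [QuotientGroup.out_eq']
    rw [QuotientGroup.eq, inv_inv] at h1
    simpa [Subgroup.mem_subgroupOf] using h1
  · rintro ⟨r, hr⟩
    have hu : ∀ k : K, ∃ u : {v : A.G | dist 1 v ≤ r}, (k : A.G)⁻¹ * u ∈ H := fun k => by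
      obtain ⟨u, hu, hku⟩ := mem_nbhd_iff.1 (hr (K.inv_mem k.2))
      exact ⟨⟨u, hu⟩, hku⟩
    choose u hu using hu
    have : Finite {v : A.G | dist 1 v ≤ r} := (A.finite_ball r).to_subtype
    have hinj : Function.Injective fun c : K ⧸ H.subgroupOf K => u c.out := by
      intro c d hcd
      rw [← QuotientGroup.out_eq' c, ← QuotientGroup.out_eq' d, QuotientGroup.eq,
        Subgroup.mem_subgroupOf]
      have h1 := H.mul_mem (hu c.out) (H.inv_mem (hu d.out))
      simp only at hcd
      rw [hcd] at h1
      simpa [mul_assoc] using h1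
    have := Finite.of_injective _ hinj
    exact Subgroup.index_ne_zero_of_finite

theorem commensurable_iff_near (H K : Subgroup A.G) :
    Subgroup.Commensurable H K ↔ ∃ r, Near r (H : Set A.G) (K : Set A.G) := by
  rw [Subgroup.Commensurable, relIndex_ne_zero_iff_subset_nbhd, relIndex_ne_zero_iff_subset_nbhd]
  constructor
  · rintro ⟨⟨r, hr⟩, s, hs⟩
    exact ⟨max r s, hs.trans (nbhd_mono (le_max_right _ _) _),
      hr.trans (nbhd_mono (le_max_left _ _) _)⟩
  · rintro ⟨r, h1, h2⟩
    exact ⟨⟨r, h2⟩, r, h1⟩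

/-- Cosets at finite Hausdorff distance correspond to commensurable conjugates. -/
theorem commensurable_conj_iff_near (g h : A.G) (P Q : Subgroup A.G) :
    Subgroup.Commensurable (conj g P) (conj h Q) ↔
      ∃ r, Near r (g • (P : Set A.G)) (h • (Q : Set A.G)) := by
  rw [commensurable_iff_near]
  constructor
  · rintro ⟨r, hr⟩
    exact ⟨_, ((near_smul_conj g P).trans hr).trans (near_smul_conj h Q).symm⟩
  · rintro ⟨r, hr⟩
    exact ⟨_, ((near_smul_conj g P).symm.trans hr).trans (near_smul_conj h Q)⟩

theorem relIndex_ne_zero_iff_finite_cosets {G : Type*} [Group G] (P K : Subgroup G) :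
    P.relIndex K ≠ 0 ↔ ((fun c : G => c • (P : Set G)) '' K).Finite := by
  have h1 : MulAction.stabilizer K (P : Set G) = P.subgroupOf K := by
    ext k
    have h := SetLike.ext_iff.1 (MulAction.stabilizer_subgroup P) (k : G)
    rw [MulAction.mem_stabilizer_iff] at h
    exact h
  have h2 : ((fun c : G => c • (P : Set G)) '' K) = MulAction.orbit K (P : Set G) := by
    ext S
    simp [MulAction.orbit, Subgroup.smul_def]
  rw [Subgroup.relIndex, ← h1, MulAction.index_stabilizer, h2]
  refine ⟨Set.finite_of_ncard_ne_zero, fun h => ?_⟩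
  rw [Ne, Set.ncard_eq_zero h]
  exact (MulAction.nonempty_orbit _).ne_empty

end GroupPair

namespace GroupPair

variable {A B : GroupPair.{u}}

/-! ### The properties of group pairs in metric terms -/

theorem infinite_conj_inf_conj_iff (g h : A.G) (P Q : Subgroup A.G) :
    ((conj g P ⊓ conj h Q : Subgroup A.G) : Set A.G).Infinite ↔
      CoarselyMeet ![g • (P : Set A.G), h • (Q : Set A.G)] := by
  have h1 : (conj g P ⊓ conj h Q : Subgroup A.G) = ⨅ i : Fin 2, conj (![g, h] i) (![P, Q] i) := by
    ext x
    simp [Subgroup.mem_iInf, Fin.forall_fin_two]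
  have h2 : ![g • (P : Set A.G), h • (Q : Set A.G)] =
      fun i : Fin 2 => ![g, h] i • ((![P, Q] i : Subgroup A.G) : Set A.G) := by
    funext i
    fin_cases i <;> rfl
  rw [h1, h2, infinite_iInf_conj_iff]

theorem exists_eq_smul_of_mem_cosets {ι : Type*} {S : ι → Set A.G} (hS : ∀ i, S i ∈ A.cosets) :
    ∃ (g : ι → A.G) (P : ι → Subgroup A.G), (∀ i, P i ∈ A.periph) ∧
      S = fun i => g i • (P i : Set A.G) := by
  choose g P hP h using hS
  exact ⟨g, P, hP, funext h⟩

theorem finiteHeight_iff : A.FiniteHeight ↔ ∃ N : ℕ, ∀ m (S : Fin m → Set A.G),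
    (∀ i, S i ∈ A.cosets) → Function.Injective S → CoarselyMeet S → m ≤ N := by
  refine exists_congr fun N => ⟨fun h m S hS hinj hmeet => ?_, fun h m g P hgP hinf => ?_⟩
  · obtain ⟨g, P, hP, rfl⟩ := exists_eq_smul_of_mem_cosets hS
    exact h m g P ⟨hP, hinj⟩ ((infinite_iInf_conj_iff g P).2 hmeet)
  · exact h m _ (fun i => ⟨g i, P i, hgP.1 i, rfl⟩) hgP.2 ((infinite_iInf_conj_iff g P).1 hinf)

theorem finiteWidth_iff : A.FiniteWidth ↔ ∃ N : ℕ, ∀ m (S : Fin m → Set A.G),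
    (∀ i, S i ∈ A.cosets) → Function.Injective S →
      (∀ i j, i ≠ j → CoarselyMeet ![S i, S j]) → m ≤ N := by
  refine exists_congr fun N => ⟨fun h m S hS hinj hmeet => ?_, fun h m g P hgP hinf => ?_⟩
  · obtain ⟨g, P, hP, rfl⟩ := exists_eq_smul_of_mem_cosets hS
    exact h m g P ⟨hP, hinj⟩ fun i j hij => (infinite_conj_inf_conj_iff _ _ _ _).2 (hmeet i j hij.ne)
  · refine h m _ (fun i => ⟨g i, P i, hgP.1 i, rfl⟩) hgP.2 fun i j hij => ?_
    rw [← infinite_conj_inf_conj_iff]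
    rcases hij.lt_or_gt with hij | hij
    · exact hinf i j hij
    · rw [inf_comm]
      exact hinf j i hij

theorem fencedInfiniteIntersections_iff : A.FencedInfiniteIntersections ↔ ∃ τ : ℝ, 0 ≤ τ ∧
    ∀ S ∈ A.cosets, ∀ T ∈ A.cosets, CoarselyMeet ![S, T] → setDist S T ≤ τ := by
  refine exists_congr fun τ => and_congr_right fun _ => ⟨?_, fun h g₁ g₂ P₁ hP₁ P₂ hP₂ hinf => ?_⟩
  · rintro h _ ⟨g₁, P₁, hP₁, rfl⟩ _ ⟨g₂, P₂, hP₂, rfl⟩ hmeet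
    exact h g₁ g₂ P₁ hP₁ P₂ hP₂ ((infinite_conj_inf_conj_iff _ _ _ _).2 hmeet)
  · exact h _ ⟨g₁, P₁, hP₁, rfl⟩ _ ⟨g₂, P₂, hP₂, rfl⟩ ((infinite_conj_inf_conj_iff _ _ _ _).1 hinf)

theorem boundedPacking_iff : A.BoundedPacking ↔ ∀ D : ℝ, ∃ N : ℕ, ∀ m (S : Fin m → Set A.G),
    (∀ i, S i ∈ A.cosets) → Function.Injective S →
      (∀ i j, i ≠ j → setDist (S i) (S j) < D) → m ≤ N := by
  refine forall_congr' fun D => ⟨?_, ?_⟩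
  · rintro ⟨N, hN⟩
    refine ⟨N, fun m S hS hinj hD => ?_⟩
    obtain ⟨g, P, hP, rfl⟩ := exists_eq_smul_of_mem_cosets hS
    by_contra! hm
    obtain ⟨i, j, hij, hDij⟩ := hN (g ∘ Fin.castLE hm.le) (P ∘ Fin.castLE hm.le)
      ⟨fun i => hP _, hinj.comp (Fin.castLE_injective hm.le)⟩
    exact (hD _ _ ((Fin.castLE_injective hm.le).ne hij)).not_ge hDij
  · rintro ⟨N, hN⟩
    refine ⟨N + 1, fun g P hgP => ?_⟩
    by_contra! h
    have := hN (N + 1) _ (fun i => ⟨g i, P i, hgP.1 i, rfl⟩) hgP.2 fun i j hij => h i j hij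
    omega

/-- Finite packing means that families of cosets with coarsely unbounded intersection meet a ball of
uniform radius, since `G` acts transitively on itself and finitely many cosets meet a given ball. -/
theorem finitePacking_iff : A.FinitePacking ↔ ∃ r : ℝ, ∀ m (S : Fin m → Set A.G),
    (∀ i, S i ∈ A.cosets) → CoarselyMeet S → ∃ x, ∀ i, x ∈ nbhd r (S i) := by
  constructor
  · rintro ⟨D, hfin, hD, h⟩
    have hρ : ∀ S ∈ D, ∃ ρ : ℝ, 1 ∈ nbhd ρ S := fun S hS => by
      obtain ⟨a, ha⟩ := nonempty_of_mem_cosets (hD hS)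
      exact ⟨dist a 1, a, ha, le_rfl⟩
    choose! ρ hρ using hρ
    obtain ⟨r, hr⟩ := (hfin.image ρ).bddAbove
    refine ⟨r, fun m S hS hmeet => ?_⟩
    obtain ⟨g, P, hP, rfl⟩ := exists_eq_smul_of_mem_cosets hS
    obtain ⟨x, hx⟩ := h m g P hP ((infinite_iInf_conj_iff g P).2 hmeet)
    refine ⟨x⁻¹, fun i => ?_⟩
    rw [← mem_nbhd_smul (g := x), mul_inv_cancel]
    exact nbhd_mono (hr ⟨_, hx i, rfl⟩) _ (hρ _ (hx i))
  · rintro ⟨r, h⟩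
    refine ⟨_, A.finite_cosets_mem_nbhd r, fun S hS => hS.1, fun m g P hP hinf => ?_⟩
    obtain ⟨x, hx⟩ := h m _ (fun i => ⟨g i, P i, hP i, rfl⟩) ((infinite_iInf_conj_iff g P).1 hinf)
    refine ⟨x⁻¹, fun i => ⟨smul_mem_cosets ⟨g i, P i, hP i, rfl⟩ _, ?_⟩⟩
    have := (mem_nbhd_smul (g := x⁻¹)).2 (hx i)
    rwa [inv_mul_cancel] at this

/-- The cosets `cP` with `c` in the commensurator of `P` are those at finite Hausdorff distance
from `P`. -/
theorem finiteIndexInCommensurator_iff : A.FiniteIndexInCommensurator ↔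
    ∀ S ∈ A.cosets, {T ∈ A.cosets | ∃ r, Near r S T}.Finite := by
  simp only [FiniteIndexInCommensurator, relIndex_ne_zero_iff_finite_cosets]
  constructor
  · intro h S hS
    have hfin : ∀ P ∈ A.periph, {T | (∃ g : A.G, T = g • (P : Set A.G)) ∧ ∃ r, Near r S T}.Finite := by
      intro P hP
      rcases Set.eq_empty_or_nonempty
        {T | (∃ g : A.G, T = g • (P : Set A.G)) ∧ ∃ r, Near r S T} with h0 | ⟨_, ⟨g₀, rfl⟩, r₀, h₀⟩
      · rw [h0]
        exact Set.finite_empty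
      refine ((h P hP).image fun T => g₀ • T).subset ?_
      rintro _ ⟨⟨g, rfl⟩, r, hr⟩
      refine ⟨(g₀⁻¹ * g) • (P : Set A.G), ⟨g₀⁻¹ * g, ?_, rfl⟩, by simp [mul_smul]⟩
      have h1 : Subgroup.Commensurable (conj (g₀⁻¹ * g) P) (conj 1 P) :=
        (commensurable_conj_iff_near _ _ _ _).2
          ⟨_, by simpa [mul_smul] using near_smul_smul (hr.symm.trans h₀) g₀⁻¹⟩
      rw [SetLike.mem_coe, Subgroup.Commensurable.commensurator_mem_iff]
      simpa [conj] using h1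
    refine (A.periph_finite.biUnion hfin).subset ?_
    rintro T ⟨⟨g, P, hP, rfl⟩, hr⟩
    exact Set.mem_biUnion hP ⟨⟨g, rfl⟩, hr⟩
  · intro h P hP
    refine (h P ⟨1, P, hP, (one_smul _ _).symm⟩).subset ?_
    rintro _ ⟨c, hc, rfl⟩
    refine ⟨⟨c, P, hP, rfl⟩, ?_⟩
    rw [SetLike.mem_coe, Subgroup.Commensurable.commensurator_mem_iff] at hc
    have h1 : Subgroup.Commensurable (conj 1 P) (conj c P) := by
      simpa [conj] using hc.symm
    simpa using (commensurable_conj_iff_near _ _ _ _).1 h1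

/-! ### Quasi-isometry invariance -/

theorem QuasiIsometric.symm (h : QuasiIsometric A B) : QuasiIsometric B A := by
  obtain ⟨L, C, M, q, hq⟩ := h
  exact hq.exists_inverse

theorem isQuasiIsometryInvariant_of_imp {𝔓 : GroupPair.{u} → Prop}
    (h : ∀ A B : GroupPair.{u}, QuasiIsometric A B → 𝔓 B → 𝔓 A) : IsQuasiIsometryInvariant 𝔓 :=
  fun A B hAB => ⟨h B A hAB.symm, h A B hAB⟩

theorem IsQuasiIsometryInvariant.isGeometric {𝔓 : GroupPair.{u} → Prop}
    (h : IsQuasiIsometryInvariant 𝔓) : IsGeometric 𝔓 :=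
  fun A B hAB hB => ⟨A, (h A B hAB).2 hB, Relation.EqvGen.refl A⟩

/-- The data used to transport properties along a quasi-isometry of group pairs: constants, the
map `q`, and a map `f` on cosets which follows `q` up to bounded Hausdorff distance and has
uniformly finite fibres. -/
theorem QuasiIsometric.exists_map (h : QuasiIsometric A B) :
    ∃ (L C M : ℝ) (q : A.G → B.G) (f : Set A.G → Set B.G) (K : ℕ), IsQuasiIsometry L C q ∧
      (∀ S ∈ A.cosets, f S ∈ B.cosets) ∧ (∀ S ∈ A.cosets, Near M (q '' S) (f S)) ∧
      ∀ T, {S ∈ A.cosets | f S = T}.encard ≤ K := by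
  obtain ⟨L, C, M, q, hq⟩ := h
  obtain ⟨f, hf⟩ := hq.exists_map
  obtain ⟨K, hK⟩ := exists_encard_fiber_le hq.quasiIsometry hf A.uniformlyLocallyFinite_cosets
    fun S hS => nonempty_of_mem_cosets hS
  exact ⟨L, C, M, q, f, K, hq.quasiIsometry, fun S hS => (hf S hS).1, fun S hS => (hf S hS).2, hK⟩

theorem coarselyMeet_pair {X Y : Type*} [PseudoMetricSpace X] [PseudoMetricSpace Y] {L C M : ℝ}
    {q : X → Y} (hq : IsQuasiIsometry L C q) {S S' : Set X} {T T' : Set Y}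
    (hS : Near M (q '' S) T) (hS' : Near M (q '' S') T') (h : CoarselyMeet ![S, S']) :
    CoarselyMeet ![T, T'] :=
  hq.coarselyMeet (M := M) (fun i => by fin_cases i; exacts [hS, hS']) h

theorem isQuasiIsometryInvariant_finiteHeight : IsQuasiIsometryInvariant.{u} FiniteHeight := by
  refine isQuasiIsometryInvariant_of_imp fun A B hAB hB => ?_
  obtain ⟨L, C, M, q, f, K, hq, hfB, hf, hK⟩ := hAB.exists_map
  rw [finiteHeight_iff] at hB ⊢
  exact exists_card_le_of_map hK hfB (Φ := fun _ S => CoarselyMeet S)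
    (Ψ := fun _ T => CoarselyMeet T)
    (fun m k S e hS _ h => hq.coarselyMeet (fun i => hf _ (hS (e i))) (h.comp e)) hB

theorem isQuasiIsometryInvariant_finiteWidth : IsQuasiIsometryInvariant.{u} FiniteWidth := by
  refine isQuasiIsometryInvariant_of_imp fun A B hAB hB => ?_
  obtain ⟨L, C, M, q, f, K, hq, hfB, hf, hK⟩ := hAB.exists_map
  rw [finiteWidth_iff] at hB ⊢
  refine exists_card_le_of_map hK hfB (Φ := fun _ S => ∀ i j, i ≠ j → CoarselyMeet ![S i, S j])
    (Ψ := fun _ T => ∀ i j, i ≠ j → CoarselyMeet ![T i, T j])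
    (fun m k S e hS he h i j hij => ?_) hB
  have he' : Function.Injective e := fun i j hij => he (by simp [hij])
  exact coarselyMeet_pair hq (hf _ (hS _)) (hf _ (hS _)) (h _ _ (he'.ne hij))

theorem isQuasiIsometryInvariant_fencedInfiniteIntersections :
    IsQuasiIsometryInvariant.{u} FencedInfiniteIntersections := by
  refine isQuasiIsometryInvariant_of_imp fun A B hAB hB => ?_
  obtain ⟨L, C, M, q, f, K, hq, hfB, hf, hK⟩ := hAB.exists_map
  rw [fencedInfiniteIntersections_iff] at hB ⊢
  obtain ⟨τ, -, hτ⟩ := hB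
  refine ⟨max 0 (L * (τ + 1 + 2 * M + C) + 1), le_max_left _ _, fun S hS T hT hmeet => ?_⟩
  have h1 := hτ _ (hfB S hS) _ (hfB T hT) (coarselyMeet_pair hq (hf S hS) (hf T hT) hmeet)
  exact (setDist_lt_of_near_image hq (hf S hS) (hf T hT) (nonempty_of_mem_cosets (hfB S hS))
    (nonempty_of_mem_cosets (hfB T hT)) (h1.trans_lt (lt_add_one τ))).le.trans (le_max_right _ _)

theorem isQuasiIsometryInvariant_boundedPacking : IsQuasiIsometryInvariant.{u} BoundedPacking := by
  refine isQuasiIsometryInvariant_of_imp fun A B hAB hB => ?_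
  obtain ⟨L, C, M, q, f, K, hq, hfB, hf, hK⟩ := hAB.exists_map
  rw [boundedPacking_iff] at hB ⊢
  intro D
  refine exists_card_le_of_map hK hfB (Φ := fun _ S => ∀ i j, i ≠ j → setDist (S i) (S j) < D)
    (Ψ := fun _ T => ∀ i j, i ≠ j → setDist (T i) (T j) < L * D + C + 2 * M + 1)
    (fun m k S e hS he h i j hij => ?_) (hB _)
  have he' : Function.Injective e := fun i j hij => he (by simp [hij])
  exact setDist_lt_of_near hq (hf _ (hS _)) (hf _ (hS _)) (nonempty_of_mem_cosets (hS _))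
    (nonempty_of_mem_cosets (hS _)) (h _ _ (he'.ne hij))

theorem isQuasiIsometryInvariant_finitePacking : IsQuasiIsometryInvariant.{u} FinitePacking := by
  refine isQuasiIsometryInvariant_of_imp fun A B hAB hB => ?_
  obtain ⟨L, C, M, q, f, K, hq, hfB, hf, hK⟩ := hAB.exists_map
  rw [finitePacking_iff] at hB ⊢
  obtain ⟨r, hr⟩ := hB
  refine ⟨L * (M + (r + C) + C), fun m S hS hmeet => ?_⟩
  obtain ⟨y, hy⟩ := hr m (f ∘ S) (fun i => hfB _ (hS i))
    (hq.coarselyMeet (fun i => hf _ (hS i)) hmeet)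
  obtain ⟨x, hx⟩ := hq.coarse_surj y
  refine ⟨x, fun i => hq.mem_nbhd_of_image (hf _ (hS i)) ?_⟩
  obtain ⟨b, hb, hby⟩ := hy i
  rw [dist_comm] at hx
  exact ⟨b, hb, (dist_triangle b y (q x)).trans (add_le_add hby hx)⟩

theorem isQuasiIsometryInvariant_finiteIndexInCommensurator :
    IsQuasiIsometryInvariant.{u} FiniteIndexInCommensurator := by
  refine isQuasiIsometryInvariant_of_imp fun A B hAB hB => ?_
  obtain ⟨L, C, M, q, f, K, hq, hfB, hf, hK⟩ := hAB.exists_map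
  rw [finiteIndexInCommensurator_iff] at hB ⊢
  intro S hS
  refine Set.Finite.of_finite_fibers f ((hB (f S) (hfB S hS)).subset ?_) fun T _ => ?_
  · rintro _ ⟨T, ⟨hT, r, hr⟩, rfl⟩
    exact ⟨hfB T hT, _, ((hf S hS).symm.trans (hq.near_image hr)).trans (hf T hT)⟩
  · refine (Set.finite_of_encard_le_coe (hK T)).subset ?_
    rintro T' ⟨⟨hT', -⟩, hTT'⟩
    exact ⟨hT', hTT'⟩

theorem isQuasiIsometryInvariant_isNetwork : IsQuasiIsometryInvariant.{u} IsNetwork := by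
  refine isQuasiIsometryInvariant_of_imp fun A B hAB ⟨⟨P, hP⟩, τ, hτ, hB⟩ => ?_
  -- Networks are pushed forward, so the inverse quasi-isometry is used.
  obtain ⟨L, C, M, q, hq⟩ := hAB.symm
  obtain ⟨_, ⟨g, Q, hQ, rfl⟩, -⟩ := hq.forth _ ⟨1, P, hP, rfl⟩
  exact ⟨⟨Q, hQ⟩, hB.of_quasiIsometryOfPairs hq (fun S hS => not_isBounded_of_mem_cosets hS) hτ⟩

theorem isQuasiIsometryInvariant_thickOfOrderOne :
    IsQuasiIsometryInvariant.{u} ThickOfOrderOne := by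
  refine isQuasiIsometryInvariant_of_imp fun A B hAB ⟨⟨⟨τ, hτ, hnet⟩, hthick⟩, hzero⟩ => ?_
  obtain ⟨L, C, M, q, hq⟩ := hAB.symm
  obtain ⟨L', C', M', p, hp⟩ := hAB
  exact ⟨⟨hnet.of_quasiIsometryOfPairs hq (fun S hS => not_isBounded_of_mem_cosets hS) hτ,
    hthick.of_quasiIsometryOfPairs hq⟩, fun h => hzero (h.of_quasiIsometry hp.quasiIsometry)⟩

/-! ### Commensurators as peripheral subgroups -/

open Subgroup.Commensurable (commensurator commensurator_mem_iff)

theorem commensurator_conj {G : Type*} [Group G] (g : G) (P : Subgroup G) :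
    commensurator (conj g P) = conj g (commensurator P) := by
  ext x
  rw [mem_conj_iff, commensurator_mem_iff, commensurator_mem_iff,
    Subgroup.Commensurable.commensurable_conj (ConjAct.toConjAct g⁻¹)]
  simp only [← mul_smul, ← ConjAct.toConjAct_mul]
  simp [mul_assoc]

theorem finite_of_relIndex_ne_zero {G : Type*} [Group G] {H K : Subgroup G}
    (hH : (H : Set G).Finite) (h : H.relIndex K ≠ 0) : (K : Set G).Finite := by
  have : Finite H := hH.to_subtype
  have h2 := Subgroup.relIndex_ne_zero_trans (H := ⊥)
    (by rw [Subgroup.relIndex_bot_left]; exact Nat.card_pos.ne') h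
  rw [Subgroup.relIndex_bot_left] at h2
  exact Nat.finite_of_card_ne_zero h2

theorem commensurable_of_eq {G : Type*} [Group G] {H K : Subgroup G} (h : H = K) :
    Subgroup.Commensurable H K := by
  subst h
  exact .refl H

theorem le_commensurator {G : Type*} [Group G] (P : Subgroup G) : P ≤ commensurator P := by
  intro x hx
  rw [commensurator_mem_iff]
  have : conj x P = P := by
    ext y
    rw [mem_conj_iff, P.mul_mem_cancel_right hx, P.mul_mem_cancel_left (P.inv_mem hx)]
  exact commensurable_of_eq this

theorem FiniteIndexInCommensurator.commensurable (hA : A.FiniteIndexInCommensurator)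
    {P : Subgroup A.G} (hP : P ∈ A.periph) : Subgroup.Commensurable P (commensurator P) :=
  ⟨hA P hP, by rw [Subgroup.relIndex_eq_one.2 (le_commensurator P)]; exact one_ne_zero⟩

theorem EqCommensurator.finiteIndexInCommensurator (hA : A.EqCommensurator) :
    A.FiniteIndexInCommensurator := fun P hP => by
  rw [← hA P hP, Subgroup.relIndex_self]
  exact one_ne_zero

theorem AlmostMalnormal.eqCommensurator (hA : A.AlmostMalnormal) : A.EqCommensurator := by
  refine fun P hP => le_antisymm (le_commensurator P) fun g hg => ?_
  rcases hA P hP P hP g with h | h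
  · rw [commensurator_mem_iff] at hg
    have h1 : (conj g P ⊓ P).relIndex P ≠ 0 := by
      rw [Subgroup.inf_relIndex_right]
      exact hg.1
    exact (A.periph_infinite P hP (finite_of_relIndex_ne_zero h h1)).elim
  · exact h.2

/-- In an almost malnormal pair distinct cosets have coarsely bounded intersection. -/
theorem AlmostMalnormal.eq_of_coarselyMeet (hA : A.AlmostMalnormal) {S T : Set A.G}
    (hS : S ∈ A.cosets) (hT : T ∈ A.cosets) (h : CoarselyMeet ![S, T]) : S = T := by
  obtain ⟨g, P, hP, rfl⟩ := hS
  obtain ⟨k, Q, hQ, rfl⟩ := hT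
  rw [← infinite_conj_inf_conj_iff] at h
  rcases hA P hP Q hQ (k⁻¹ * g) with hfin | ⟨rfl, hgk⟩
  · refine (h ?_).elim
    have h1 : (conj g P ⊓ conj k Q : Subgroup A.G) = conj k (conj (k⁻¹ * g) P ⊓ Q) := by
      ext x
      simp only [Subgroup.mem_inf, mem_conj_iff]
      group
    rw [h1, Subgroup.coe_pointwise_smul]
    exact hfin.smul_set
  · exact smul_coe_eq_of_mem (Set.mem_smul_set_iff_inv_smul_mem.2 hgk)

/-- In a pair quasi-isometric to an almost malnormal one, cosets with coarsely unbounded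
intersection are at finite Hausdorff distance. -/
theorem AlmostMalnormal.exists_near_of_coarselyMeet (hAB : QuasiIsometric A B)
    (hB : B.AlmostMalnormal) {S T : Set A.G} (hS : S ∈ A.cosets) (hT : T ∈ A.cosets)
    (h : CoarselyMeet ![S, T]) : ∃ r, Near r S T := by
  obtain ⟨L, C, M, q, f, K, hq, hfB, hf, hK⟩ := hAB.exists_map
  have h1 := hB.eq_of_coarselyMeet (hfB S hS) (hfB T hT)
    (coarselyMeet_pair hq (hf S hS) (hf T hT) h)
  exact ⟨_, hq.near_of_near_image (hf S hS) (hf T hT) (by rw [h1]; exact Near.refl le_rfl _)⟩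

/-- The pair obtained from `A` by changing the peripheral structure. -/
abbrev withPeriph (A : GroupPair.{u}) (𝒬 : Set (Subgroup A.G)) (hfin : 𝒬.Finite)
    (hinf : ∀ Q ∈ 𝒬, (Q : Set A.G).Infinite) : GroupPair.{u} :=
  { A with periph := 𝒬, periph_finite := hfin, periph_infinite := hinf }

/-- Replacing each `P ∈ 𝒫` by a subgroup `F P` commensurable to a conjugate of `P` gives a virtually
isomorphic pair. -/
theorem exists_virtuallyIsomorphic_of_commensurable (F : Subgroup A.G → Subgroup A.G)
    (hF : ∀ P ∈ A.periph, ∃ g, Subgroup.Commensurable P (conj g (F P))) :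
    ∃ (hfin : (F '' A.periph).Finite) (hinf : ∀ Q ∈ F '' A.periph, (Q : Set A.G).Infinite),
      VirtuallyIsomorphic (A.withPeriph (F '' A.periph) hfin hinf) A := by
  have hinf : ∀ Q ∈ F '' A.periph, (Q : Set A.G).Infinite := by
    rintro _ ⟨P, hP, rfl⟩ hfin
    obtain ⟨g, hg⟩ := hF P hP
    refine A.periph_infinite P hP (finite_of_relIndex_ne_zero ?_ hg.2)
    rw [Subgroup.coe_pointwise_smul]
    exact hfin.smul_set
  refine ⟨A.periph_finite.image F, hinf, Relation.EqvGen.rel _ _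
    (VirtualStep.commensurable (MulEquiv.refl A.G) ?_ ?_)⟩
  · intro P hP
    obtain ⟨g, hg⟩ := hF P hP
    refine ⟨F P, ⟨P, hP, rfl⟩, g, ?_⟩
    rw [show (F P).map (MulEquiv.refl A.G).toMonoidHom = F P from Subgroup.map_id _]
    exact hg
  · rintro _ ⟨P, hP, rfl⟩
    obtain ⟨g, hg⟩ := hF P hP
    refine ⟨P, hP, g⁻¹, ?_⟩
    rw [show (F P).map (MulEquiv.refl A.G).toMonoidHom = F P from Subgroup.map_id _]
    have := hg.symm.conj (ConjAct.toConjAct g⁻¹)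
    rwa [← mul_smul, ← ConjAct.toConjAct_mul, inv_mul_cancel, ConjAct.toConjAct_one, one_smul]
      at this

theorem isGeometric_eqCommensurator : IsGeometric.{u} EqCommensurator := by
  intro A B hAB hB
  have hA : A.FiniteIndexInCommensurator :=
    (isQuasiIsometryInvariant_finiteIndexInCommensurator A B hAB).2 hB.finiteIndexInCommensurator
  obtain ⟨hfin, hinf, hK⟩ := exists_virtuallyIsomorphic_of_commensurable (A := A)
    (fun P => commensurator P) fun P hP => ⟨1, by simpa [conj] using hA.commensurable hP⟩
  refine ⟨_, ?_, hK⟩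
  rintro _ ⟨P, hP, rfl⟩
  exact (hA.commensurable hP).eq

/-- The commensurators of the peripheral subgroups, with one chosen in each conjugacy class, form an
almost malnormal collection. -/
theorem isGeometric_almostMalnormal : IsGeometric.{u} AlmostMalnormal := by
  intro A B hAB hB
  have hA : A.FiniteIndexInCommensurator :=
    (isQuasiIsometryInvariant_finiteIndexInCommensurator A B hAB).2
      hB.eqCommensurator.finiteIndexInCommensurator
  -- `rep P` is the chosen conjugate of the commensurator of `P`; it depends only on the conjugacy
  -- class of that commensurator.
  let rep : Subgroup A.G → Subgroup A.G := fun P =>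
    (Quotient.mk (MulAction.orbitRel (ConjAct A.G) (Subgroup A.G)) (commensurator P)).out
  have hrep : ∀ P, ∃ a : A.G, rep P = conj a (commensurator P) := fun P => by
    obtain ⟨a, ha⟩ := Quotient.mk_out (s := MulAction.orbitRel (ConjAct A.G) (Subgroup A.G))
      (commensurator P)
    exact ⟨ConjAct.ofConjAct a, ha.symm⟩
  have hrep_eq : ∀ P P' : Subgroup A.G, ∀ g, conj g (rep P) = rep P' → rep P = rep P' := by
    intro P P' g h
    have h1 : Quotient.mk (MulAction.orbitRel (ConjAct A.G) (Subgroup A.G)) (rep P') =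
        Quotient.mk _ (rep P) := Quotient.sound ⟨ConjAct.toConjAct g, h⟩
    simp only [rep, Quotient.out_eq] at h1
    simp only [rep, h1]
  obtain ⟨hfin, hinf, hK⟩ := exists_virtuallyIsomorphic_of_commensurable (A := A) rep
    fun P hP => by
      obtain ⟨a, ha⟩ := hrep P
      refine ⟨a⁻¹, ?_⟩
      rw [ha, ← conj_mul, inv_mul_cancel]
      simpa [conj] using hA.commensurable hP
  refine ⟨_, ?_, hK⟩
  rintro _ ⟨P, hP, rfl⟩ _ ⟨P', hP', rfl⟩ g
  refine or_iff_not_imp_left.2 fun hinter => ?_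
  obtain ⟨a, ha⟩ := hrep P
  obtain ⟨b, hb⟩ := hrep P'
  have hcomm : ∀ P ∈ A.periph, ∀ a : A.G,
      ∃ r, Near r (a • (commensurator P : Set A.G)) (a • (P : Set A.G)) := fun P hP a =>
    (commensurable_conj_iff_near _ _ _ _).1 ((hA.commensurable hP).symm.conj _)
  have hmeet : CoarselyMeet ![(g * a) • (commensurator P : Set A.G),
      b • (commensurator P' : Set A.G)] := by
    rw [← infinite_conj_inf_conj_iff, conj_mul, ← ha, ← hb]
    exact hinter
  obtain ⟨r, hr⟩ := hcomm P hP (g * a)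
  obtain ⟨s, hs⟩ := hcomm P' hP' b
  have hmeet' : CoarselyMeet ![(g * a) • (P : Set A.G), b • (P' : Set A.G)] := by
    refine hmeet.mono (r := max r s) fun i => ?_
    fin_cases i
    exacts [hr.1.trans (nbhd_mono (le_max_left _ _) _), hs.1.trans (nbhd_mono (le_max_right _ _) _)]
  have hconj : conj g (rep P) = rep P' := by
    have h1 := (commensurable_conj_iff_near _ _ _ _).2
      (hB.exists_near_of_coarselyMeet hAB ⟨g * a, P, hP, rfl⟩ ⟨b, P', hP', rfl⟩ hmeet')
    have h2 := h1.eq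
    rw [commensurator_conj, commensurator_conj, conj_mul, ← ha, ← hb] at h2
    exact h2
  have heq := hrep_eq P P' g hconj
  refine ⟨heq, ?_⟩
  have hself : commensurator (rep P) = rep P := by
    rw [ha, commensurator_conj, ← (hA.commensurable hP).eq]
  change g ∈ rep P
  rw [← hself, commensurator_mem_iff]
  exact commensurable_of_eq (hconj.trans heq.symm)

end GroupPair

end CosetGeom

theorem theorem1p3 :
    (CosetGeom.GroupPair.IsGeometric.{u} CosetGeom.GroupPair.FiniteHeight ∧
      CosetGeom.GroupPair.IsGeometric.{u} CosetGeom.GroupPair.FiniteWidth ∧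
      CosetGeom.GroupPair.IsGeometric.{u} CosetGeom.GroupPair.FencedInfiniteIntersections ∧
      CosetGeom.GroupPair.IsGeometric.{u} CosetGeom.GroupPair.AlmostMalnormal ∧
      CosetGeom.GroupPair.IsGeometric.{u} CosetGeom.GroupPair.IsNetwork ∧
      CosetGeom.GroupPair.IsGeometric.{u} CosetGeom.GroupPair.ThickOfOrderOne ∧
      CosetGeom.GroupPair.IsGeometric.{u} CosetGeom.GroupPair.EqCommensurator ∧
      CosetGeom.GroupPair.IsGeometric.{u} CosetGeom.GroupPair.FiniteIndexInCommensurator ∧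
      CosetGeom.GroupPair.IsGeometric.{u} CosetGeom.GroupPair.BoundedPacking ∧
      CosetGeom.GroupPair.IsGeometric.{u} CosetGeom.GroupPair.FinitePacking) ∧
    (CosetGeom.GroupPair.IsQuasiIsometryInvariant.{u} CosetGeom.GroupPair.FiniteHeight ∧
      CosetGeom.GroupPair.IsQuasiIsometryInvariant.{u} CosetGeom.GroupPair.FiniteWidth ∧
      CosetGeom.GroupPair.IsQuasiIsometryInvariant.{u}
        CosetGeom.GroupPair.FencedInfiniteIntersections ∧
      CosetGeom.GroupPair.IsQuasiIsometryInvariant.{u} CosetGeom.GroupPair.IsNetwork ∧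
      CosetGeom.GroupPair.IsQuasiIsometryInvariant.{u} CosetGeom.GroupPair.ThickOfOrderOne ∧
      CosetGeom.GroupPair.IsQuasiIsometryInvariant.{u}
        CosetGeom.GroupPair.FiniteIndexInCommensurator ∧
      CosetGeom.GroupPair.IsQuasiIsometryInvariant.{u} CosetGeom.GroupPair.BoundedPacking ∧
      CosetGeom.GroupPair.IsQuasiIsometryInvariant.{u} CosetGeom.GroupPair.FinitePacking) := by
  open CosetGeom.GroupPair in
  exact ⟨⟨isQuasiIsometryInvariant_finiteHeight.isGeometric,
      isQuasiIsometryInvariant_finiteWidth.isGeometric,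
      isQuasiIsometryInvariant_fencedInfiniteIntersections.isGeometric,
      isGeometric_almostMalnormal,
      isQuasiIsometryInvariant_isNetwork.isGeometric,
      isQuasiIsometryInvariant_thickOfOrderOne.isGeometric,
      isGeometric_eqCommensurator,
      isQuasiIsometryInvariant_finiteIndexInCommensurator.isGeometric,
      isQuasiIsometryInvariant_boundedPacking.isGeometric,
      isQuasiIsometryInvariant_finitePacking.isGeometric⟩,
    isQuasiIsometryInvariant_finiteHeight, isQuasiIsometryInvariant_finiteWidth,
    isQuasiIsometryInvariant_fencedInfiniteIntersections, isQuasiIsometryInvariant_isNetwork,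
    isQuasiIsometryInvariant_thickOfOrderOne,
    isQuasiIsometryInvariant_finiteIndexInCommensurator,
    isQuasiIsometryInvariant_boundedPacking, isQuasiIsometryInvariant_finitePacking⟩
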